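/- Let $n\ge 2$, let $A,B,C\in\mathbb C^{n\times n}$ be Hermitian with $A\succ 0$, put $F(\lambda)=\lambda^2A+\lambda B+C$, and suppose $F(\lambda_0)\prec 0$ for some $\lambda_0\in\mathbb R$. Let $\lambda_1^+\le\lambda_2^+\le\dots$ be the eigenvalues of $F$ (the zeros of $\det F$, counted with multiplicity) in $(\lambda_0,\infty)$. For $x\ne0$ let $\rho(x)$ be the unique root of $x^{\mathsf H}F(\lambda)x$ in $(\lambda_0,\infty)$. Fix $K\succ 0$ and an integer $m_e\ge 1$. The method $\mathrm{LOCG}(1,m_e)$ with the fixed preconditioner $K$ starts from some $x_0\neq 0$, $\rho_0=\rho(x_0)$, $x_{-1}=0$; for $i=0,1,2,\dots$ it takes a matrix $Z_i$ whose columns form a basis of $$\operatorname{span}\{x_i,\,KF(\rho_i)x_i,\,\dots,\,(KF(\rho_i))^{m_e}x_i,\,x_{i-1}\},$$ computes the smallest eigenvalue $\rho_{i+1}$ in $(\lambda_0,\infty)$ of the projected polynomial $Z_i^{\mathsf H}F(\lambda)Z_i$ together with a corresponding eigenvector $y_i\ne 0$, and puts $x_{i+1}=Z_iy_i$. The iterates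 may be scaled arbitrarily, for instance so that $x_i^{\mathsf H}Ax_i=1$. Let $\{\rho_i\},\{x_i\},\{Z_i\}$ be produced in this way, and suppose that $\lambda_1^+\le\rho_0<\lambda_2^+$ and that $Z_i^{\mathsf H}K^{1/2}F'(\lambda_1^+)K^{1/2}Z_i\succ 0$ for all $i$. Then: 1. The sequence $\rho_i$ is nonincreasing and converges to $\lambda_1^+$ as $i\to\infty$, and $x_i$ converges in direction to a corresponding eigenvector: there are $u\neq 0$ with $F(\lambda_1^+)u=0$ and nonzero scalars $c_i\in\mathbb C$ with $c_ix_i\to u$. If $x_i^{\mathsf H}Ax_i=1$ for all $i$, then $F(\rho_i)x_i\to 0$. 2. Let $\gamma$ and $\Gamma$ be the smallest and the largest positive eigenvalue of $-KF(\lambda_1^+)$. There are $\varepsilon>0$ and $M$, depending only on $A,B,C,\lambda_0,K,m_e$ and not on the sequences, such that for every $i\ge 1$ with $\rho_i-\lambda_1^+<\varepsilon$ $$\rho_{i+1}-\lambda_1^+\le\eta^2(\rho_{i-1}-\lambda_1^+)+M(\rho_{i-1}-\lambda_1^+)^{3/2},$$ where $$\eta=\frac{2}{\Delta^{2m_e}+\Delta^{-2m_e}},\qquad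 \Delta=\frac{\sqrt\kappa+1}{\sqrt\kappa-1},\qquad \kappa=\frac{\Gamma}{\gamma},$$ with $\eta=0$ if $\kappa=1$. -/

import Mathlib

open Filter Topology
open scoped ComplexOrder MatrixOrder

/-- The quadratic matrix polynomial `F(t) = t² A + t B + C`, evaluated at a real number `t`. -/
noncomputable def quadF {n : ℕ} (A B C : Matrix (Fin n) (Fin n) ℂ) (t : ℝ) :
    Matrix (Fin n) (Fin n) ℂ :=
  ((t : ℂ) ^ 2) • A + (t : ℂ) • B + C

/-- The derivative `F'(t) = 2 t A + B`. -/
noncomputable def quadF' {n : ℕ} (A B : Matrix (Fin n) (Fin n) ℂ) (t : ℝ) :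
    Matrix (Fin n) (Fin n) ℂ :=
  (2 * (t : ℂ)) • A + B

/-- The polynomial `det F(z)` in the indeterminate `z`. -/
noncomputable def quadDet {n : ℕ} (A B C : Matrix (Fin n) (Fin n) ℂ) : Polynomial ℂ :=
  ((Polynomial.X : Polynomial ℂ) ^ 2 • A.map Polynomial.C
    + (Polynomial.X : Polynomial ℂ) • B.map Polynomial.C + C.map Polynomial.C).det

open Classical in
/-- The number of eigenvalues of `F` (roots of `det F`, counted with multiplicity) that are real
and lie in `(lam0, t]`. -/
noncomputable def eigCount {n : ℕ} (A B C : Matrix (Fin n) (Fin n) ℂ) (lam0 t : ℝ) : ℕ :=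
  ((quadDet A B C).roots.filter (fun z => z.im = 0 ∧ lam0 < z.re ∧ z.re ≤ t)).card

/-- The `k`-th smallest eigenvalue of `F` in `(lam0, ∞)`, counted with multiplicity (`k ≥ 1`):
the smallest `t` such that `(lam0, t]` contains at least `k` eigenvalues. For hyperbolic `F` of size
`n` there are `n` eigenvalues in `(lam0, ∞)`, so that this is meaningful for `1 ≤ k ≤ n`. -/
noncomputable def posEig {n : ℕ} (A B C : Matrix (Fin n) (Fin n) ℂ) (lam0 : ℝ) (k : ℕ) : ℝ :=
  sInf {t : ℝ | k ≤ eigCount A B C lam0 t}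

/-- `(μ, y)` is an eigenpair of the matrix function `G` with `μ` the smallest eigenvalue of `G` in
`(lam0, ∞)`. -/
def IsMinEigenpair {k : ℕ} (G : ℝ → Matrix (Fin k) (Fin k) ℂ) (lam0 : ℝ) (μ : ℝ)
    (y : Fin k → ℂ) : Prop :=
  lam0 < μ ∧ y ≠ 0 ∧ (G μ).mulVec y = 0 ∧
    ∀ (ν : ℝ) (w : Fin k → ℂ), lam0 < ν → w ≠ 0 → (G ν).mulVec w = 0 → μ ≤ ν

/-- The Krylov subspace `span {v, M v, …, M ^ m v}`. -/
def krylov {n : ℕ} (m : ℕ) (M : Matrix (Fin n) (Fin n) ℂ) (v : Fin n → ℂ) :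
    Submodule ℂ (Fin n → ℂ) :=
  Submodule.span ℂ {w | ∃ j : ℕ, j ≤ m ∧ w = (M ^ j).mulVec v}

/-- The previous iterate `x_{i-1}`, with `x_{-1} = 0`. -/
def prevIter {n : ℕ} (x : ℕ → Fin n → ℂ) : ℕ → Fin n → ℂ
  | 0 => 0
  | i + 1 => x i

/-- `ρ`, `x`, `Z`, `y` are produced by the locally optimal preconditioned extended conjugate
gradient method (block size one, extension size `m`, preconditioners `K i`) for
`F(t) = t² A + t B + C` and the interval `(lam0, ∞)`. The scaling of the nonzero iterates `x i`
is left free. -/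
structure IsLOCG {n : ℕ} (A B C : Matrix (Fin n) (Fin n) ℂ) (lam0 : ℝ) (m : ℕ)
    (K : ℕ → Matrix (Fin n) (Fin n) ℂ) (ρ : ℕ → ℝ) (x : ℕ → Fin n → ℂ) (d : ℕ → ℕ)
    (Z : (i : ℕ) → Matrix (Fin n) (Fin (d i)) ℂ) (y : (i : ℕ) → Fin (d i) → ℂ) : Prop where
  init_ne : x 0 ≠ 0
  init_gt : lam0 < ρ 0
  /-- `ρ 0` is the Rayleigh quotient of `x 0`: the root of `x₀ᴴ F(t) x₀` in `(lam0, ∞)`. -/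
  init_root : dotProduct (star (x 0)) ((quadF A B C (ρ 0)).mulVec (x 0)) = 0
  /-- The columns of `Z i` form a basis of the search space. -/
  basis_indep : ∀ i, LinearIndependent ℂ (Z i).transpose
  basis_span : ∀ i, Submodule.span ℂ (Set.range (Z i).transpose) =
    krylov m (K i * quadF A B C (ρ i)) (x i) ⊔ Submodule.span ℂ {prevIter x i}
  /-- The smallest eigenpair of the projected problem. -/
  eigenpair : ∀ i, IsMinEigenpair
    (fun t => (Z i).conjTranspose * quadF A B C t * Z i) lam0 (ρ (i + 1)) (y i)
  iterate : ∀ i, x (i + 1) = (Z i).mulVec (y i)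

/-- The positive eigenvalues of a matrix. -/
def positiveEigenvalues {n : ℕ} (M : Matrix (Fin n) (Fin n) ℂ) : Set ℝ :=
  {g : ℝ | 0 < g ∧ Module.End.HasEigenvalue (Matrix.toLin' M) (g : ℂ)}

/-- `η = 2 / (Δ^{2m} + Δ^{-2m})` with `Δ = (√κ + 1) / (√κ - 1)`; for `κ = 1` one has `Δ = ∞` and
`η = 0`. -/
noncomputable def chebRate (κ : ℝ) (m : ℕ) : ℝ :=
  if κ = 1 then 0
  else 2 / (((√κ + 1) / (√κ - 1)) ^ (2 * m) + (((√κ + 1) / (√κ - 1)) ^ (2 * m))⁻¹)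

/-!
Write `λ` for the smallest eigenvalue of `F` in `(lam0, ∞)`, `δᵢ = ρᵢ - λ` and `H = -F(λ)`.

*Convergence.* Each new pair is a Galerkin solution: its residual is orthogonal to the search space
(`IsLOCG.galerkin`), and `F(ρᵢ₊₁)` is nonpositive on that space (`IsLOCG.re_dotProduct_nonpos`,
from `IsMinEigenpair.posSemidef_neg`). As the search space contains `xᵢ` and `K F(ρᵢ) xᵢ`, the `ρᵢ`
decrease, and any limit point `w` of the normalised iterates satisfies `F(lim ρᵢ) w = 0`. Because
`ρ₀ < λ₂`, at most one eigenvalue, counted with multiplicity, lies in `(lam0, ρ₀]`; so the limit is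
`λ`, and its eigenspace is a line since geometric multiplicity is bounded by algebraic multiplicity
(`pow_dvd_quadDet`).

*Rate.* The congruence by `K^{1/2}` reduces to `K = 1`. Then `H` is positive semidefinite with
kernel spanned by a vector `u`, its other eigenvalues lie in `[γ, Γ]`, and the iterates can be
scaled to `u + eᵢ` with `eᵢ = O(√δᵢ)`. Up to `O(δ^{3/2})`, `δᵢ` is proportional to the energy
`⟨eᵢ, H eᵢ⟩`. Let `p` be the Chebyshev polynomial of degree `m` on `[γ, Γ]` with `p(0) = 1`, and
let `s` be its squared maximum there. Orthogonality in the first step gives `⟨p(H) e₀, H e₁⟩ =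
⟨e₁, H e₁⟩ + O(δ₀^{3/2})`. In the second step the vector `α p(-F(ρ₁)) x₁ + (1 - α) x₀` with `α = 2
/ (2 - s)` is admissible. In its energy the terms with `⟨e₁, H e₁⟩` cancel, and `(1 - α)² ⟨e₀, H
e₀⟩` is left, where `(1 - α)² = (s / (2 - s))² = η²` by the identity `T_{2m} = 2 T_m² - 1`
(`two_step_estimate`). Working with the filter of all admissible data with `δ₀ → 0` makes the
constants uniform (`exists_uniform_two_step`). For `δ₀` bounded away from zero the estimate holds
by monotonicity.
-/

/-! ### Hyperbolic quadratic forms -/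

open Matrix in
theorem quadF_isHermitian {n : ℕ} {A B C : Matrix (Fin n) (Fin n) ℂ} (hA : A.IsHermitian)
    (hB : B.IsHermitian) (hC : C.IsHermitian) (t : ℝ) : (quadF A B C t).IsHermitian := by
  simp only [Matrix.IsHermitian, quadF, conjTranspose_add, conjTranspose_smul, hA.eq, hB.eq, hC.eq]
  simp

theorem continuous_quadF {n : ℕ} (A B C : Matrix (Fin n) (Fin n) ℂ) :
    Continuous (quadF A B C) := by
  unfold quadF
  fun_prop

theorem quadF_add {n : ℕ} (A B C : Matrix (Fin n) (Fin n) ℂ) (t δ : ℝ) :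
    quadF A B C (t + δ) =
      quadF A B C t + (δ : ℂ) • quadF' A B t + ((δ : ℂ) ^ 2) • A := by
  simp only [quadF, quadF']
  push_cast
  module

theorem dotProduct_smul_mulVec_smul {n : ℕ} (M : Matrix (Fin n) (Fin n) ℂ) (c : ℂ)
    (x : Fin n → ℂ) :
    star (c • x) ⬝ᵥ M.mulVec (c • x) = ((‖c‖ ^ 2 : ℝ) : ℂ) * (star x ⬝ᵥ M.mulVec x) := by
  rw [star_smul, Matrix.mulVec_smul, smul_dotProduct, dotProduct_smul, smul_smul, smul_eq_mul]
  congr 1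
  simpa using Complex.conj_mul' c

theorem Matrix.star_mulVec_dotProduct_mulVec {n k : ℕ} (M : Matrix (Fin n) (Fin n) ℂ)
    (Z : Matrix (Fin n) (Fin k) ℂ) (v w : Fin k → ℂ) :
    star (Z.mulVec v) ⬝ᵥ M.mulVec (Z.mulVec w) =
      star v ⬝ᵥ (Z.conjTranspose * M * Z).mulVec w := by
  rw [Matrix.star_mulVec, ← Matrix.dotProduct_mulVec, Matrix.mulVec_mulVec, Matrix.mulVec_mulVec,
    Matrix.mul_assoc]

theorem Matrix.IsHermitian.posSemidef_of_re {n : ℕ} {M : Matrix (Fin n) (Fin n) ℂ}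
    (hM : M.IsHermitian) (h : ∀ x : Fin n → ℂ, 0 ≤ (star x ⬝ᵥ M.mulVec x).re) :
    M.PosSemidef :=
  .of_dotProduct_mulVec_nonneg hM fun x =>
    Complex.nonneg_iff.2 ⟨h x, (hM.im_star_dotProduct_mulVec_self x).symm⟩

/-- A continuous Hermitian matrix function which is negative definite at `lam0` is still negative
semidefinite at its smallest eigenvalue in `(lam0, ∞)`: the first `t` at which some unit vector has
a nonnegative value is itself an eigenvalue. -/
theorem IsMinEigenpair.posSemidef_neg {k : ℕ} {G : ℝ → Matrix (Fin k) (Fin k) ℂ} {lam0 μ : ℝ}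
    {y : Fin k → ℂ} (hG : Continuous G) (hH : ∀ t, (G t).IsHermitian)
    (h0 : (-(G lam0)).PosDef) (h : IsMinEigenpair G lam0 μ y) : (-(G μ)).PosSemidef := by
  obtain ⟨hμ, hy, hGy, hmin⟩ := h
  set q : ℝ × (Fin k → ℂ) → ℝ := fun p => (star p.2 ⬝ᵥ (G p.1).mulVec p.2).re with hq
  have hqc : Continuous q := by
    refine Complex.continuous_re.comp ?_
    exact Continuous.dotProduct (by fun_prop)
      ((hG.comp continuous_fst).matrix_mulVec continuous_snd)
  have hscale : ∀ (t : ℝ) (c : ℂ) (x : Fin k → ℂ), q (t, c • x) = ‖c‖ ^ 2 * q (t, x) := by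
    intro t c x
    simp only [hq, dotProduct_smul_mulVec_smul, Complex.re_ofReal_mul]
  have hunit : ∀ x : Fin k → ℂ, x ≠ 0 →
      ((‖x‖⁻¹ : ℝ) : ℂ) • x ∈ Metric.sphere (0 : Fin k → ℂ) 1 := by
    intro x hx
    simp [norm_smul, hx]
  have hKc : IsCompact ((Set.Icc lam0 μ ×ˢ Metric.sphere (0 : Fin k → ℂ) 1) ∩ {p | 0 ≤ q p}) :=
    (isCompact_Icc.prod (isCompact_sphere _ _)).inter_right (isClosed_le continuous_const hqc)
  obtain ⟨⟨t, x⟩, ⟨⟨ht, hx⟩, hqx⟩, hmin'⟩ := hKc.exists_isMinOn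
    ⟨(μ, ((‖y‖⁻¹ : ℝ) : ℂ) • y), ⟨⟨⟨hμ.le, le_rfl⟩, hunit y hy⟩, by
      simp only [Set.mem_ofPred_eq, hscale]; simp [hq, hGy]⟩⟩ continuous_fst.continuousOn
  simp only [Set.mem_ofPred_eq] at hx hqx ht
  have hx0 : x ≠ 0 := by
    rintro rfl; simp at hx
  have hlt : ∀ s ∈ Set.Ico lam0 t, ∀ z, q (s, z) ≤ 0 := by
    intro s hs z
    rcases eq_or_ne z 0 with rfl | hz
    · simp [hq]
    by_contra! hc
    have := hmin' (show (s, ((‖z‖⁻¹ : ℝ) : ℂ) • z) ∈ _ from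
      ⟨⟨⟨hs.1, hs.2.le.trans ht.2⟩, hunit z hz⟩, by
        simp only [Set.mem_ofPred_eq, hscale]; positivity⟩)
    exact absurd hs.2 (not_lt.2 this)
  have hlam : lam0 < t := by
    refine lt_of_le_of_ne ht.1 ?_
    rintro rfl
    have := h0.dotProduct_mulVec_pos hx0
    rw [Matrix.neg_mulVec, dotProduct_neg, Complex.pos_iff] at this
    simp only [hq] at hqx
    have h1 := this.1
    simp only [Complex.neg_re] at h1
    linarith
  have hle : ∀ z, q (t, z) ≤ 0 := by
    intro z
    have hc : Tendsto (fun s => q (s, z)) (𝓝[<] t) (𝓝 (q (t, z))) :=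
      (Continuous.tendsto (by fun_prop) t).mono_left nhdsWithin_le_nhds
    refine le_of_tendsto hc ?_
    filter_upwards [Ico_mem_nhdsLT hlam] with s hs using hlt s hs z
  have hpsd : (-(G t)).PosSemidef := by
    refine Matrix.IsHermitian.posSemidef_of_re (hH t).neg fun z => ?_
    rw [Matrix.neg_mulVec, dotProduct_neg, Complex.neg_re]
    simpa [hq] using hle z
  have hGx : (G t).mulVec x = 0 := by
    have h1 : star x ⬝ᵥ (-(G t)).mulVec x = 0 := by
      rw [Matrix.neg_mulVec, dotProduct_neg, neg_eq_zero]
      exact Complex.ext (le_antisymm (hle x) hqx) ((hH t).im_star_dotProduct_mulVec_self x)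
    have h2 := (hpsd.dotProduct_mulVec_zero_iff x).1 h1
    rwa [Matrix.neg_mulVec, neg_eq_zero] at h2
  have : t = μ := le_antisymm ht.2 (hmin t x hlam hx0 hGx)
  exact this ▸ hpsd

/-- The scalar quadratic `xᴴ F(t) x` has positive leading coefficient and is negative at `lam0`, so
it is positive to the right of its root `ρ > lam0`. -/
theorem le_root_of_quadF_nonpos {n : ℕ} {A B C : Matrix (Fin n) (Fin n) ℂ} {lam0 : ℝ}
    (hA : A.PosDef) (hF : (-(quadF A B C lam0)).PosDef) {x : Fin n → ℂ} (hx : x ≠ 0) {ρ t : ℝ}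
    (hρ : lam0 < ρ) (hroot : star x ⬝ᵥ (quadF A B C ρ).mulVec x = 0)
    (ht : (star x ⬝ᵥ (quadF A B C t).mulVec x).re ≤ 0) : t ≤ ρ := by
  have e : ∀ s : ℝ, (star x ⬝ᵥ (quadF A B C s).mulVec x).re =
      s ^ 2 * (star x ⬝ᵥ A.mulVec x).re + s * (star x ⬝ᵥ B.mulVec x).re +
        (star x ⬝ᵥ C.mulVec x).re := by
    intro s
    simp only [quadF, Matrix.add_mulVec, Matrix.smul_mulVec, dotProduct_add, dotProduct_smul,
      smul_eq_mul, Complex.add_re, ← Complex.ofReal_pow, Complex.re_ofReal_mul]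
  have ha := (Complex.pos_iff.1 (hA.dotProduct_mulVec_pos hx)).1
  have h0 := (Complex.pos_iff.1 (hF.dotProduct_mulVec_pos hx)).1
  rw [Matrix.neg_mulVec, dotProduct_neg, Complex.neg_re, e] at h0
  have h1 := congrArg Complex.re hroot
  rw [e] at h1 ht
  simp only [Complex.zero_re] at h1
  by_contra! hc
  set a := (star x ⬝ᵥ A.mulVec x).re
  set b := (star x ⬝ᵥ B.mulVec x).re
  -- The slope of the chord over `[lam0, ρ]` is positive, the one over `[ρ, t]` is larger.
  have h2 : 0 < (ρ - lam0) * (a * (ρ + lam0) + b) := by linarith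
  have h3 : 0 < a * (ρ + lam0) + b := (mul_pos_iff_of_pos_left (by linarith)).1 h2
  have h4 : (t - ρ) * (a * (t + ρ) + b) ≤ 0 := by linarith
  have h5 : 0 < a * (t + ρ) + b := by nlinarith
  nlinarith [mul_pos (sub_pos.2 hc) h5]

/-! ### Orthogonality and minimality of the iterates -/

/-- The space from which the `(i + 1)`-st iterate is chosen. -/
noncomputable def searchSpace {n : ℕ} (A B C K : Matrix (Fin n) (Fin n) ℂ) (m : ℕ) (ρ : ℕ → ℝ)
    (x : ℕ → Fin n → ℂ) (i : ℕ) : Submodule ℂ (Fin n → ℂ) :=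
  krylov m (K * quadF A B C (ρ i)) (x i) ⊔ Submodule.span ℂ {prevIter x i}

section searchSpace

variable {n : ℕ} {A B C K : Matrix (Fin n) (Fin n) ℂ} {m : ℕ} {ρ : ℕ → ℝ} {x : ℕ → Fin n → ℂ}

theorem pow_mulVec_mem_searchSpace (i : ℕ) {j : ℕ} (hj : j ≤ m) :
    ((K * quadF A B C (ρ i)) ^ j).mulVec (x i) ∈ searchSpace A B C K m ρ x i :=
  Submodule.mem_sup_left (Submodule.subset_span ⟨j, hj, rfl⟩)

theorem self_mem_searchSpace (i : ℕ) : x i ∈ searchSpace A B C K m ρ x i := by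
  simpa using pow_mulVec_mem_searchSpace (A := A) (B := B) (C := C) (K := K) (ρ := ρ) (x := x)
    i (Nat.zero_le m)

theorem prev_mem_searchSpace (i : ℕ) : x i ∈ searchSpace A B C K m ρ x (i + 1) :=
  Submodule.mem_sup_right (Submodule.subset_span rfl)

end searchSpace

namespace IsLOCG

variable {n : ℕ} {A B C K : Matrix (Fin n) (Fin n) ℂ} {lam0 : ℝ} {m : ℕ} {ρ : ℕ → ℝ}
  {x : ℕ → Fin n → ℂ} {d : ℕ → ℕ} {Z : (i : ℕ) → Matrix (Fin n) (Fin (d i)) ℂ}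
  {y : (i : ℕ) → Fin (d i) → ℂ}

theorem exists_mulVec_of_mem (h : IsLOCG A B C lam0 m (fun _ => K) ρ x d Z y) {i : ℕ}
    {z : Fin n → ℂ} (hz : z ∈ searchSpace A B C K m ρ x i) : ∃ w, (Z i).mulVec w = z := by
  have h1 : z ∈ Submodule.span ℂ (Set.range (Z i).col) := by
    have := h.basis_span i
    rw [searchSpace, ← this] at hz
    exact hz
  rw [← Matrix.range_mulVecLin] at h1
  exact h1

theorem mulVec_injective (h : IsLOCG A B C lam0 m (fun _ => K) ρ x d Z y) (i : ℕ) :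
    Function.Injective (Z i).mulVec :=
  Matrix.mulVec_injective_iff.2 (h.basis_indep i)

theorem iterate_mem (h : IsLOCG A B C lam0 m (fun _ => K) ρ x d Z y) (i : ℕ) :
    x (i + 1) ∈ searchSpace A B C K m ρ x i := by
  have h1 : (Z i).mulVec (y i) ∈ LinearMap.range (Z i).mulVecLin := ⟨y i, rfl⟩
  rw [Matrix.range_mulVecLin] at h1
  rw [h.iterate i, searchSpace, ← h.basis_span i]
  exact h1

theorem iterate_ne (h : IsLOCG A B C lam0 m (fun _ => K) ρ x d Z y) : ∀ i, x i ≠ 0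
  | 0 => h.init_ne
  | i + 1 => by
    rw [h.iterate i]
    intro h0
    exact (h.eigenpair i).2.1 (h.mulVec_injective i (by rw [h0, Matrix.mulVec_zero]))

theorem lt_rho (h : IsLOCG A B C lam0 m (fun _ => K) ρ x d Z y) : ∀ i, lam0 < ρ i
  | 0 => h.init_gt
  | i + 1 => (h.eigenpair i).1

/-- The residual of an iterate is orthogonal to the space it was chosen from. -/
theorem galerkin (h : IsLOCG A B C lam0 m (fun _ => K) ρ x d Z y) {i : ℕ}
    {z : Fin n → ℂ} (hz : z ∈ searchSpace A B C K m ρ x i) :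
    star z ⬝ᵥ (quadF A B C (ρ (i + 1))).mulVec (x (i + 1)) = 0 := by
  obtain ⟨w, rfl⟩ := h.exists_mulVec_of_mem hz
  rw [h.iterate i, Matrix.star_mulVec_dotProduct_mulVec, (h.eigenpair i).2.2.1, dotProduct_zero]

theorem rayleigh_root (h : IsLOCG A B C lam0 m (fun _ => K) ρ x d Z y) :
    ∀ i, star (x i) ⬝ᵥ (quadF A B C (ρ i)).mulVec (x i) = 0
  | 0 => h.init_root
  | i + 1 => h.galerkin (h.iterate_mem i)

/-- The minimality of `ρ (i + 1)`: the form `F(ρ (i + 1))` is nonpositive on the search space. -/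
theorem re_dotProduct_nonpos (h : IsLOCG A B C lam0 m (fun _ => K) ρ x d Z y) (hA : A.IsHermitian)
    (hB : B.IsHermitian) (hC : C.IsHermitian) (hF : (-(quadF A B C lam0)).PosDef) {i : ℕ}
    {z : Fin n → ℂ} (hz : z ∈ searchSpace A B C K m ρ x i) :
    (star z ⬝ᵥ (quadF A B C (ρ (i + 1))).mulVec z).re ≤ 0 := by
  obtain ⟨w, rfl⟩ := h.exists_mulVec_of_mem hz
  have hpos : (-((Z i).conjTranspose * quadF A B C lam0 * Z i)).PosDef := by
    have := hF.conjTranspose_mul_mul_same (h.mulVec_injective i)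
    simpa [Matrix.mul_neg, Matrix.neg_mul] using this
  have hps := (h.eigenpair i).posSemidef_neg
    ((continuous_const.matrix_mul (continuous_quadF A B C)).matrix_mul continuous_const)
    (fun t => Matrix.isHermitian_conjTranspose_mul_mul (Z i) (quadF_isHermitian hA hB hC t)) hpos
  have := (Complex.nonneg_iff.1 (hps.dotProduct_mulVec_nonneg w)).1
  rw [Matrix.neg_mulVec, dotProduct_neg, Complex.neg_re] at this
  rw [Matrix.star_mulVec_dotProduct_mulVec]
  linarith

theorem antitone (h : IsLOCG A B C lam0 m (fun _ => K) ρ x d Z y) (hA : A.PosDef)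
    (hB : B.IsHermitian) (hC : C.IsHermitian) (hF : (-(quadF A B C lam0)).PosDef) : Antitone ρ :=
  antitone_nat_of_succ_le fun i =>
    le_root_of_quadF_nonpos hA hF (h.iterate_ne i) (h.lt_rho i) (h.rayleigh_root i)
      (h.re_dotProduct_nonpos hA.isHermitian hB hC hF (self_mem_searchSpace i))

/-- Limit points of rescaled iterates are annihilated by `F` at the limit of the Rayleigh
quotients: moving from such a point `w` in the direction `K F(r) w` would otherwise lower the
Rayleigh quotient by a fixed amount. -/
theorem mulVec_limit_eq_zero (h : IsLOCG A B C lam0 m (fun _ => K) ρ x d Z y)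
    (hA : A.IsHermitian) (hB : B.IsHermitian) (hC : C.IsHermitian)
    (hF : (-(quadF A B C lam0)).PosDef) (hK : K.PosDef) (hm : 1 ≤ m) {r : ℝ}
    (hρ : Tendsto ρ atTop (𝓝 r)) {φ : ℕ → ℕ} (hφ : Tendsto φ atTop atTop) {c : ℕ → ℂ}
    {w : Fin n → ℂ} (hw : Tendsto (fun j => c j • x (φ j)) atTop (𝓝 w)) :
    (quadF A B C r).mulVec w = 0 := by
  have hρφ : Tendsto (fun j => ρ (φ j)) atTop (𝓝 r) := hρ.comp hφ
  have hρφ1 : Tendsto (fun j => ρ (φ j + 1)) atTop (𝓝 r) :=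
    hρ.comp ((tendsto_add_atTop_nat 1).comp hφ)
  have hFc := (continuous_quadF A B C).tendsto r
  have hroot : star w ⬝ᵥ (quadF A B C r).mulVec w = 0 := by
    have hc : Continuous fun p : ℝ × (Fin n → ℂ) => star p.2 ⬝ᵥ (quadF A B C p.1).mulVec p.2 :=
      Continuous.dotProduct (by fun_prop)
        (((continuous_quadF A B C).comp continuous_fst).matrix_mulVec continuous_snd)
    have h1 := (hc.tendsto (r, w)).comp (hρφ.prodMk_nhds hw)
    refine tendsto_nhds_unique h1 ?_
    refine tendsto_const_nhds.congr fun j => ?_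
    simp only [Function.comp, dotProduct_smul_mulVec_smul, h.rayleigh_root, mul_zero]
  set v := (quadF A B C r).mulVec w with hv
  have htest : ∀ t : ℝ, (star (w + (t : ℂ) • K.mulVec v) ⬝ᵥ
      (quadF A B C r).mulVec (w + (t : ℂ) • K.mulVec v)).re ≤ 0 := by
    intro t
    have hc : Continuous fun p : ℝ × ℝ × (Fin n → ℂ) =>
        (star (p.2.2 + (t : ℂ) • K.mulVec ((quadF A B C p.1).mulVec p.2.2)) ⬝ᵥ
        (quadF A B C p.2.1).mulVec
          (p.2.2 + (t : ℂ) • K.mulVec ((quadF A B C p.1).mulVec p.2.2))).re := by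
      have h1 : Continuous fun p : ℝ × ℝ × (Fin n → ℂ) =>
          p.2.2 + (t : ℂ) • K.mulVec ((quadF A B C p.1).mulVec p.2.2) :=
        continuous_snd.snd.add <| Continuous.const_smul (continuous_const.matrix_mulVec <|
          ((continuous_quadF A B C).comp continuous_fst).matrix_mulVec continuous_snd.snd) (t : ℂ)
      exact Complex.continuous_re.comp (Continuous.dotProduct (continuous_star.comp h1)
        (((continuous_quadF A B C).comp continuous_snd.fst).matrix_mulVec h1))
    have h1 := (hc.tendsto (r, r, w)).comp (hρφ.prodMk_nhds (hρφ1.prodMk_nhds hw))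
    refine le_of_tendsto h1 (Eventually.of_forall fun j => ?_)
    refine h.re_dotProduct_nonpos hA hB hC hF (i := φ j) ?_
    refine Submodule.add_mem _ (Submodule.smul_mem _ _ (self_mem_searchSpace _))
      (Submodule.smul_mem _ _ ?_)
    rw [Matrix.mulVec_smul, Matrix.mulVec_smul]
    refine Submodule.smul_mem _ _ ?_
    have := pow_mulVec_mem_searchSpace (A := A) (B := B) (C := C) (K := K) (ρ := ρ) (x := x)
      (φ j) hm
    rwa [pow_one, ← Matrix.mulVec_mulVec] at this
  have hFH := quadF_isHermitian hA hB hC r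
  have hexp : ∀ t : ℝ, (star (w + (t : ℂ) • K.mulVec v) ⬝ᵥ
      (quadF A B C r).mulVec (w + (t : ℂ) • K.mulVec v)).re =
      2 * t * (star v ⬝ᵥ K.mulVec v).re +
        t ^ 2 * (star (K.mulVec v) ⬝ᵥ (quadF A B C r).mulVec (K.mulVec v)).re := by
    intro t
    have h2 : star w ⬝ᵥ (quadF A B C r).mulVec (K.mulVec v) = star v ⬝ᵥ K.mulVec v := by
      rw [hv, Matrix.star_mulVec, ← Matrix.dotProduct_mulVec, hFH.eq]
    have h3 : star (K.mulVec v) ⬝ᵥ v = star v ⬝ᵥ K.mulVec v := by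
      rw [Matrix.star_mulVec, ← Matrix.dotProduct_mulVec, hK.isHermitian.eq]
    rw [star_add, star_smul, Matrix.mulVec_add, Matrix.mulVec_smul, add_dotProduct, dotProduct_add,
      dotProduct_add, hroot, ← hv, dotProduct_smul, smul_dotProduct, smul_dotProduct,
      dotProduct_smul, h2, h3]
    simp only [smul_eq_mul, RCLike.star_def, Complex.conj_ofReal, zero_add, Complex.add_re,
      Complex.re_ofReal_mul]
    ring
  by_contra hne
  have hpos := (Complex.pos_iff.1 (hK.dotProduct_mulVec_pos hne)).1
  set a := (star v ⬝ᵥ K.mulVec v).re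
  set b := (star (K.mulVec v) ⬝ᵥ (quadF A B C r).mulVec (K.mulVec v)).re
  have h4 := htest (a / (|b| + 1))
  rw [hexp] at h4
  have hb : 0 < |b| + 1 := by positivity
  have h5 : 0 < a / (|b| + 1) := div_pos hpos hb
  have h6 : a / (|b| + 1) * (|b| + 1) = a := by field_simp
  have h7 : -|b| ≤ b := neg_abs_le b
  nlinarith [mul_pos h5 h5, mul_pos h5 hpos]

end IsLOCG

/-! ### Multiplicity of eigenvalues -/

open Polynomial in
theorem eval_quadDet {n : ℕ} (A B C : Matrix (Fin n) (Fin n) ℂ) (t : ℝ) :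
    (quadDet A B C).eval (t : ℂ) = (quadF A B C t).det := by
  rw [quadDet, ← coe_evalRingHom, RingHom.map_det]
  congr 1
  ext i j
  simp [quadF, pow_two, mul_comm (t : ℂ)]

theorem quadDet_ne_zero {n : ℕ} {A B C : Matrix (Fin n) (Fin n) ℂ} {t : ℝ}
    (hF : (-(quadF A B C t)).PosDef) : quadDet A B C ≠ 0 := by
  intro h0
  have h1 := eval_quadDet A B C t
  rw [h0, Polynomial.eval_zero] at h1
  have h2 := (Matrix.isUnit_iff_isUnit_det _).1 hF.isUnit
  rw [Matrix.det_neg, ← h1] at h2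
  simp at h2

theorem exists_mulVec_eq_zero_iff_isRoot {n : ℕ} {A B C : Matrix (Fin n) (Fin n) ℂ} {t : ℝ} :
    (∃ w ≠ 0, (quadF A B C t).mulVec w = 0) ↔ (quadDet A B C).IsRoot (t : ℂ) := by
  rw [Polynomial.IsRoot.def, eval_quadDet, Matrix.exists_mulVec_eq_zero_iff]

open Polynomial in
/-- Geometric multiplicity is at most algebraic multiplicity: in an eigenbasis of the Hermitian
matrix `F(t)`, the rows of `F(z)` that belong to the eigenvalue zero are divisible by `z - t`. -/
theorem pow_dvd_quadDet {n : ℕ} {A B C : Matrix (Fin n) (Fin n) ℂ} {t : ℝ}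
    (hH : (quadF A B C t).IsHermitian) :
    ((X : ℂ[X]) - Polynomial.C (t : ℂ)) ^
      (Finset.univ.filter fun k => hH.eigenvalues k = 0).card ∣ quadDet A B C := by
  set e := hH.eigenvalues with he
  set U : Matrix (Fin n) (Fin n) ℂ := (hH.eigenvectorUnitary).1 with hU
  have hUU : star U * U = 1 := Unitary.coe_star_mul_self hH.eigenvectorUnitary
  have hdiag : star U * quadF A B C t * U = Matrix.diagonal fun k => (e k : ℂ) := by
    have := hH.conjStarAlgAut_star_eigenvectorUnitary
    rw [Unitary.conjStarAlgAut_apply] at this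
    simpa [hU, he, Function.comp_def] using this
  set c : ℂ →+* ℂ[X] := Polynomial.C
  set P : Matrix (Fin n) (Fin n) ℂ[X] := (X : ℂ[X]) ^ 2 • A.map c + (X : ℂ[X]) • B.map c + C.map c
    with hP
  set G : Matrix (Fin n) (Fin n) ℂ[X] := (X + c t) • A.map c + B.map c with hG
  have hPG : P = (quadF A B C t).map c + (X - c t) • G := by
    ext1 i j
    simp only [hP, hG, quadF, Matrix.add_apply, Matrix.smul_apply, Matrix.map_apply, smul_eq_mul,
      map_add, map_mul, map_pow]
    ring
  have hdet : quadDet A B C = ((star U).map c * P * U.map c).det := by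
    have h1 : (star U).map c * U.map c = 1 := by
      rw [← Matrix.map_mul, hUU]; simp
    have h2 := congrArg Matrix.det h1
    rw [Matrix.det_mul, Matrix.det_one] at h2
    rw [Matrix.det_mul, Matrix.det_mul, mul_right_comm, h2, one_mul]
    rfl
  set v : Fin n → ℂ[X] := fun k => if e k = 0 then X - c t else 1 with hv
  set Q : Matrix (Fin n) (Fin n) ℂ[X] := Matrix.of fun k l =>
    if e k = 0 then ((star U).map c * G * U.map c : Matrix (Fin n) (Fin n) ℂ[X]) k l
    else ((star U).map c * P * U.map c : Matrix (Fin n) (Fin n) ℂ[X]) k l with hQ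
  have hN : (star U).map c * P * U.map c = Matrix.of fun k l => v k * Q k l := by
    ext1 k l
    rw [Matrix.of_apply, hv, hQ, Matrix.of_apply]
    dsimp only
    split_ifs with hk
    · have h3 : (star U).map c * (quadF A B C t).map c * U.map c =
          (Matrix.diagonal fun k => (e k : ℂ)).map c := by
        rw [← hdiag, Matrix.map_mul, Matrix.map_mul]
      rw [hPG, Matrix.mul_add, Matrix.add_mul, h3, Matrix.mul_smul, Matrix.smul_mul,
        Matrix.add_apply, Matrix.smul_apply, smul_eq_mul, Matrix.map_apply, Matrix.diagonal_apply]
      simp [hk]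
    · simp
  rw [hdet, hN, Matrix.det_mul_column v Q, hv, Finset.prod_ite, Finset.prod_const,
    Finset.prod_const_one, mul_one]
  exact dvd_mul_right _ _

section eigCount

variable {n : ℕ} {A B C : Matrix (Fin n) (Fin n) ℂ} {lam0 : ℝ}

theorem le_eigCount_of_subset {t : ℝ} {s : Multiset ℂ} (hs : s ≤ (quadDet A B C).roots)
    (h : ∀ z ∈ s, z.im = 0 ∧ lam0 < z.re ∧ z.re ≤ t) : s.card ≤ eigCount A B C lam0 t :=
  Multiset.card_le_card (Multiset.le_filter.2 ⟨hs, h⟩)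

theorem bddBelow_eigCount {k : ℕ} (hk : 1 ≤ k) : BddBelow {t : ℝ | k ≤ eigCount A B C lam0 t} := by
  refine ⟨lam0, fun t ht => ?_⟩
  have h1 : 0 < eigCount A B C lam0 t := hk.trans ht
  obtain ⟨z, hz⟩ := Multiset.card_pos_iff_exists_mem.1 h1
  have h2 := (Multiset.mem_filter.1 hz).2
  exact (h2.2.1.trans_le h2.2.2).le

theorem eigCount_le_one_of_lt {t : ℝ} (ht : t < posEig A B C lam0 2) :
    eigCount A B C lam0 t ≤ 1 := by
  by_contra! hc
  exact absurd (csInf_le (bddBelow_eigCount one_le_two) hc) (not_le.2 ht)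

/-- If `(lam0, T]` contains at most one eigenvalue, then an eigenvalue `r` in it is the smallest
one and is simple. -/
theorem smallest_of_eigCount_le_one (hF : (-(quadF A B C lam0)).PosDef) {T r : ℝ}
    (hT : eigCount A B C lam0 T ≤ 1) (hr : lam0 < r) (hrT : r ≤ T) {w : Fin n → ℂ} (hw : w ≠ 0)
    (hFw : (quadF A B C r).mulVec w = 0) :
    posEig A B C lam0 1 = r ∧ IsMinEigenpair (quadF A B C) lam0 r w := by
  have hne := quadDet_ne_zero hF
  have hmem : ∀ {ν : ℝ}, (∃ v ≠ 0, (quadF A B C ν).mulVec v = 0) →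
      (ν : ℂ) ∈ (quadDet A B C).roots := fun h =>
    (Polynomial.mem_roots hne).2 (exists_mulVec_eq_zero_iff_isRoot.1 h)
  have hr' := hmem ⟨w, hw, hFw⟩
  have hlow : ∀ z ∈ (quadDet A B C).roots, z.im = 0 → lam0 < z.re → r ≤ z.re := by
    intro z hz hz0 hz1
    by_contra! hc
    have hzr : z ≠ (r : ℂ) := fun h => by simp [h] at hc
    have h2 : ({z, (r : ℂ)} : Multiset ℂ) ≤ (quadDet A B C).roots := by
      rw [Multiset.le_iff_subset (by simpa using hzr)]
      intro a ha
      rcases Multiset.mem_cons.1 ha with rfl | ha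
      · exact hz
      · rw [Multiset.mem_singleton.1 ha]; exact hr'
    have h3 := le_eigCount_of_subset (lam0 := lam0) (t := T) h2 (by
      intro a ha
      rcases Multiset.mem_cons.1 ha with rfl | ha
      · exact ⟨hz0, hz1, hc.le.trans hrT⟩
      · rw [Multiset.mem_singleton.1 ha]; exact ⟨by simp, by simpa, by simpa⟩)
    have h4 : ({z, (r : ℂ)} : Multiset ℂ).card = 2 := by simp
    omega
  refine ⟨IsLeast.csInf_eq ⟨?_, ?_⟩, hr, hw, hFw, ?_⟩
  · have h2 := le_eigCount_of_subset (lam0 := lam0) (t := r)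
      (Multiset.singleton_le.2 hr') (by
        intro a ha
        rw [Multiset.mem_singleton.1 ha]; exact ⟨by simp, by simpa, by simp⟩)
    simpa using h2
  · intro t ht
    obtain ⟨z, hz⟩ := Multiset.card_pos_iff_exists_mem.1 (show 0 < eigCount A B C lam0 t from ht)
    have h2 := Multiset.mem_filter.1 hz
    exact (hlow z h2.1 h2.2.1 h2.2.2.1).trans h2.2.2.2
  · intro ν v hν hv hFv
    exact_mod_cast hlow ν (hmem ⟨v, hv, hFv⟩) (by simp) (by simpa)

theorem ker_eq_of_eigCount_le_one (hH : ∀ t, (quadF A B C t).IsHermitian)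
    (hF : (-(quadF A B C lam0)).PosDef) {T r : ℝ}
    (hT : eigCount A B C lam0 T ≤ 1) (hr : lam0 < r) (hrT : r ≤ T) {w : Fin n → ℂ} (hw : w ≠ 0)
    (hFw : (quadF A B C r).mulVec w = 0) {v : Fin n → ℂ} (hv : (quadF A B C r).mulVec v = 0) :
    ∃ c : ℂ, v = c • w := by
  have hne := quadDet_ne_zero hF
  have hmult : (Finset.univ.filter fun k => (hH r).eigenvalues k = 0).card ≤ 1 := by
    refine le_trans ?_ hT
    have h1 := (Polynomial.le_rootMultiplicity_iff hne).2 (pow_dvd_quadDet (hH r))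
    rw [← Polynomial.count_roots, Multiset.le_count_iff_replicate_le] at h1
    have h2 := le_eigCount_of_subset (lam0 := lam0) (t := T) h1 (by
      intro a ha
      rw [Multiset.eq_of_mem_replicate ha]; exact ⟨by simp, by simpa, by simpa⟩)
    simpa using h2
  have hrank := (hH r).rank_eq_card_non_zero_eigs
  rw [Fintype.card_subtype] at hrank
  have hsum := Finset.card_filter_add_card_filter_not (s := (Finset.univ : Finset (Fin n)))
    (fun k => (hH r).eigenvalues k = 0)
  have hdim := LinearMap.finrank_range_add_finrank_ker (quadF A B C r).mulVecLin
  have hker : Module.finrank ℂ (LinearMap.ker (quadF A B C r).mulVecLin) ≤ 1 := by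
    rw [Matrix.rank] at hrank
    simp only [Finset.card_univ, Fintype.card_fin, Module.finrank_fintype_fun_eq_card] at hsum hdim
    simp only [ne_eq] at hrank
    omega
  obtain ⟨g, hg⟩ := finrank_le_one_iff.1 hker
  obtain ⟨a, ha⟩ := hg ⟨w, hFw⟩
  obtain ⟨b, hb⟩ := hg ⟨v, hv⟩
  have ha' : a • (g : Fin n → ℂ) = w := congrArg Subtype.val ha
  have hb' : b • (g : Fin n → ℂ) = v := congrArg Subtype.val hb
  have ha0 : a ≠ 0 := by
    rintro rfl; exact hw (by rw [← ha', zero_smul])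
  exact ⟨b / a, by rw [← ha', ← hb', smul_smul, div_mul_cancel₀ _ ha0]⟩

end eigCount

/-! ### Convergence -/

namespace IsLOCG

variable {n : ℕ} {A B C K : Matrix (Fin n) (Fin n) ℂ} {lam0 : ℝ} {m : ℕ} {ρ : ℕ → ℝ}
  {x : ℕ → Fin n → ℂ} {d : ℕ → ℕ} {Z : (i : ℕ) → Matrix (Fin n) (Fin (d i)) ℂ}
  {y : (i : ℕ) → Fin (d i) → ℂ}

theorem exists_subseq_limit (h : IsLOCG A B C lam0 m (fun _ => K) ρ x d Z y) (ψ : ℕ → ℕ) :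
    ∃ w : Fin n → ℂ, w ≠ 0 ∧ ∃ φ : ℕ → ℕ, StrictMono φ ∧
      Tendsto (fun j => ((‖x (ψ (φ j))‖⁻¹ : ℝ) : ℂ) • x (ψ (φ j))) atTop (𝓝 w) := by
  have hunit : ∀ j, ((‖x (ψ j)‖⁻¹ : ℝ) : ℂ) • x (ψ j) ∈ Metric.sphere (0 : Fin n → ℂ) 1 := by
    intro j
    simp [norm_smul, h.iterate_ne]
  obtain ⟨w, hw, φ, hφ, hlim⟩ := (isCompact_sphere (0 : Fin n → ℂ) 1).tendsto_subseq hunit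
  refine ⟨w, ?_, φ, hφ, hlim⟩
  rintro rfl
  simp at hw

/-- The Rayleigh quotients converge to the smallest eigenvalue, which is simple. -/
theorem exists_simple_limit (h : IsLOCG A B C lam0 m (fun _ => K) ρ x d Z y) (hA : A.PosDef)
    (hB : B.IsHermitian) (hC : C.IsHermitian) (hF : (-(quadF A B C lam0)).PosDef)
    (hK : K.PosDef) (hm : 1 ≤ m) (hlt : ρ 0 < posEig A B C lam0 2) :
    Tendsto ρ atTop (𝓝 (posEig A B C lam0 1)) ∧ ∃ u : Fin n → ℂ,
      IsMinEigenpair (quadF A B C) lam0 (posEig A B C lam0 1) u ∧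
      ∀ v, (quadF A B C (posEig A B C lam0 1)).mulVec v = 0 → ∃ c : ℂ, v = c • u := by
  have hanti := h.antitone hA hB hC hF
  obtain ⟨r, hr⟩ : ∃ r, Tendsto ρ atTop (𝓝 r) :=
    ⟨_, tendsto_atTop_ciInf hanti ⟨lam0, by rintro _ ⟨i, rfl⟩; exact (h.lt_rho i).le⟩⟩
  obtain ⟨u, hu, φ, hφ, hlim⟩ := h.exists_subseq_limit id
  have hFu := h.mulVec_limit_eq_zero hA.isHermitian hB hC hF hK hm hr hφ.tendsto_atTop hlim
  have hle : lam0 ≤ r := ge_of_tendsto hr (Eventually.of_forall fun i => (h.lt_rho i).le)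
  have hlam : lam0 < r := by
    refine lt_of_le_of_ne hle ?_
    rintro rfl
    have := hF.dotProduct_mulVec_pos hu
    rw [Matrix.neg_mulVec, hFu] at this
    simp at this
  have hr0 : r ≤ ρ 0 := hanti.le_of_tendsto hr 0
  have hone := eigCount_le_one_of_lt hlt
  obtain ⟨heq, hmin⟩ := smallest_of_eigCount_le_one hF hone hlam hr0 hu hFu
  rw [heq]
  exact ⟨hr, u, hmin, fun v hv => ker_eq_of_eigCount_le_one
    (quadF_isHermitian hA.isHermitian hB hC) hF hone hlam hr0 hu hFu hv⟩

/-- Convergence in direction, when all limit points lie on one line. -/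
theorem exists_scaling_tendsto (h : IsLOCG A B C lam0 m (fun _ => K) ρ x d Z y)
    (hA : A.IsHermitian) (hB : B.IsHermitian) (hC : C.IsHermitian)
    (hF : (-(quadF A B C lam0)).PosDef) (hK : K.PosDef) (hm : 1 ≤ m) {r : ℝ}
    (hρ : Tendsto ρ atTop (𝓝 r)) {u : Fin n → ℂ} (hu : u ≠ 0)
    (hker : ∀ v, (quadF A B C r).mulVec v = 0 → ∃ c : ℂ, v = c • u) :
    ∃ c : ℕ → ℂ, (∀ i, c i ≠ 0) ∧ Tendsto (fun i => c i • x i) atTop (𝓝 u) := by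
  classical
  set N : ℂ := star u ⬝ᵥ u with hN
  have hN0 : N ≠ 0 := fun h0 => hu (dotProduct_star_self_eq_zero.1 h0)
  refine ⟨fun i => if star u ⬝ᵥ x i = 0 then 1 else N / (star u ⬝ᵥ x i), fun i => ?_, ?_⟩
  · dsimp only
    split_ifs with h0
    · exact one_ne_zero
    · exact div_ne_zero hN0 h0
  · refine tendsto_of_subseq_tendsto fun ψ hψ => ?_
    obtain ⟨w, hw, φ, hφ, hlim⟩ := h.exists_subseq_limit ψ
    obtain ⟨b, rfl⟩ := hker w
      (h.mulVec_limit_eq_zero hA hB hC hF hK hm hρ (hψ.comp hφ.tendsto_atTop) hlim)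
    have hb : b ≠ 0 := by
      rintro rfl; exact hw (zero_smul _ _)
    refine ⟨φ, ?_⟩
    have hdot : Tendsto (fun j => star u ⬝ᵥ (((‖x (ψ (φ j))‖⁻¹ : ℝ) : ℂ) • x (ψ (φ j)))) atTop
        (𝓝 (b * N)) := by
      have hc : Continuous fun v : Fin n → ℂ => star u ⬝ᵥ v :=
        Continuous.dotProduct continuous_const continuous_id
      have := (hc.tendsto (b • u)).comp hlim
      rwa [dotProduct_smul, smul_eq_mul] at this
    have hbN : b * N ≠ 0 := mul_ne_zero hb hN0
    have h1 := ((tendsto_const_nhds (x := N)).div hdot hbN).smul hlim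
    have h2 : (N / (b * N)) • b • u = u := by
      rw [smul_smul, div_mul_eq_mul_div, mul_comm N b, div_self hbN, one_smul]
    rw [h2] at h1
    refine h1.congr' ?_
    filter_upwards [hdot.eventually_ne hbN] with j hj
    rw [dotProduct_smul, smul_eq_mul] at hj
    have hj1 := left_ne_zero_of_mul hj
    have hj2 := right_ne_zero_of_mul hj
    simp only [Pi.div_apply, if_neg hj2, dotProduct_smul, smul_eq_mul]
    rw [smul_smul]
    rw [div_mul_eq_mul_div, mul_comm N, mul_div_mul_left _ _ hj1]

/-- Under the normalisation `xᵢᴴ A xᵢ = 1` the scaling factors of `exists_scaling_tendsto` have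
moduli bounded away from zero, so that the residuals tend to zero. -/
theorem residual_tendsto_zero {r : ℝ} (hA : A.PosDef) (hρ : Tendsto ρ atTop (𝓝 r))
    {u : Fin n → ℂ} (hu : u ≠ 0) (hFu : (quadF A B C r).mulVec u = 0) {c : ℕ → ℂ}
    (hc : ∀ i, c i ≠ 0) (hlim : Tendsto (fun i => c i • x i) atTop (𝓝 u))
    (hx : ∀ i, star (x i) ⬝ᵥ A.mulVec (x i) = 1) :
    Tendsto (fun i => (quadF A B C (ρ i)).mulVec (x i)) atTop (𝓝 0) := by
  have hcA : Continuous fun v : Fin n → ℂ => (star v ⬝ᵥ A.mulVec v).re :=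
    Complex.continuous_re.comp
      (Continuous.dotProduct continuous_star (continuous_const.matrix_mulVec continuous_id))
  have h1 := (hcA.tendsto u).comp hlim
  have hupos := (Complex.pos_iff.1 (hA.dotProduct_mulVec_pos hu)).1
  have h2 : Tendsto (fun i => ‖c i‖ ^ 2) atTop (𝓝 (star u ⬝ᵥ A.mulVec u).re) := by
    refine h1.congr fun i => ?_
    simp only [Function.comp, dotProduct_smul_mulVec_smul, hx, mul_one, Complex.ofReal_re]
  have h3 : Tendsto (fun i => ‖c i‖⁻¹) atTop (𝓝 (√(star u ⬝ᵥ A.mulVec u).re)⁻¹) := by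
    have := (Real.continuous_sqrt.tendsto _).comp h2
    refine (this.congr fun i => ?_).inv₀ (Real.sqrt_pos.2 hupos).ne'
    simp [Real.sqrt_sq]
  have h4 : Tendsto (fun i => (quadF A B C (ρ i)).mulVec (c i • x i)) atTop (𝓝 0) := by
    have hcF : Continuous fun p : ℝ × (Fin n → ℂ) => (quadF A B C p.1).mulVec p.2 :=
      ((continuous_quadF A B C).comp continuous_fst).matrix_mulVec continuous_snd
    have := (hcF.tendsto (r, u)).comp (hρ.prodMk_nhds hlim)
    dsimp only at this
    rwa [hFu] at this
  rw [tendsto_zero_iff_norm_tendsto_zero] at h4 ⊢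
  have h5 := h3.mul h4
  rw [mul_zero] at h5
  refine h5.congr fun i => ?_
  rw [Matrix.mulVec_smul, norm_smul, inv_mul_cancel_left₀ (norm_ne_zero_iff.2 (hc i))]

end IsLOCG

/-! ### Chebyshev polynomials -/

open Polynomial in
/-- The rescaled Chebyshev polynomial `p` of degree `m` on `[γ, Γ]` with `p(0) = 1`. Its squared
maximum `s = T_m(x₀)⁻²`, where `x₀ = (Γ + γ) / (Γ - γ)`, enters the two-step rate through
`s / (2 - s) = T_{2m}(x₀)⁻¹`. For `γ = Γ` the linear polynomial `1 - t / γ` gives `s = 0`. -/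
theorem exists_chebyshev {γ Γ : ℝ} (hγ : 0 < γ) (hγΓ : γ ≤ Γ) {m : ℕ} (hm : 1 ≤ m) :
    ∃ (p : ℝ[X]) (s : ℝ), p.natDegree ≤ m ∧ p.eval 0 = 1 ∧ s ≤ 1 ∧
      (∀ t ∈ Set.Icc γ Γ, p.eval t ^ 2 ≤ s) ∧ s / (2 - s) = chebRate (Γ / γ) m := by
  rcases hγΓ.eq_or_lt with rfl | hlt
  · refine ⟨1 - C γ⁻¹ * X, 0, ?_, by simp, zero_le_one, ?_, ?_⟩
    · refine le_trans ?_ hm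
      compute_degree
    · rintro t ⟨h1, h2⟩
      simp [le_antisymm h2 h1, hγ.ne']
    · simp [chebRate, hγ.ne']
  have hd : 0 < Γ - γ := sub_pos.2 hlt
  have hκ : 1 < Γ / γ := (one_lt_div hγ).2 hlt
  have hκ0 : 0 < Γ / γ := by linarith
  have hsq : √(Γ / γ) ^ 2 = Γ / γ := Real.sq_sqrt hκ0.le
  have hs1 : 1 < √(Γ / γ) := by rw [Real.lt_sqrt zero_le_one]; simpa
  set D : ℝ := (√(Γ / γ) + 1) / (√(Γ / γ) - 1) with hD
  have hD0 : 0 < D := div_pos (by linarith) (by linarith)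
  set x₀ : ℝ := (Γ + γ) / (Γ - γ) with hx₀
  have hxD : x₀ = (D + D⁻¹) / 2 := by
    have h1 : √(Γ / γ) - 1 ≠ 0 := by linarith
    have h2 : √(Γ / γ) + 1 ≠ 0 := by linarith
    have h3 : D + D⁻¹ = 2 * (Γ / γ + 1) / (Γ / γ - 1) := by
      rw [← hsq, hD]
      have h4 : √(Γ / γ) ^ 2 - 1 ≠ 0 := by nlinarith
      field_simp
      ring
    rw [h3, hx₀]
    have h5 : Γ / γ - 1 ≠ 0 := by linarith
    field_simp
  set τ : ℝ := (D ^ m + (D ^ m)⁻¹) / 2 with hτ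
  have hDm : 0 < D ^ m := pow_pos hD0 m
  have hT : (Chebyshev.T ℝ (m : ℤ)).eval x₀ = τ := by
    have h1 := Chebyshev.T_real_cosh (Real.log D) (m : ℤ)
    rw [Real.cosh_log hD0] at h1
    rw [hxD, h1]
    have h2 : ((m : ℤ) : ℝ) * Real.log D = Real.log (D ^ m) := by rw [Real.log_pow]; simp
    rw [h2, Real.cosh_log hDm]
  have hτ1 : 1 ≤ τ := by
    rw [hτ, le_div_iff₀ two_pos]
    have h1 : D ^ m * (D ^ m)⁻¹ = 1 := mul_inv_cancel₀ hDm.ne'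
    have h2 : 0 < (D ^ m)⁻¹ := by positivity
    nlinarith [sq_nonneg (D ^ m - (D ^ m)⁻¹)]
  have hτ0 : 0 < τ := by linarith
  refine ⟨C τ⁻¹ * (Chebyshev.T ℝ (m : ℤ)).comp (C x₀ - C (2 / (Γ - γ)) * X), (τ ^ 2)⁻¹, ?_, ?_,
    inv_le_one_of_one_le₀ (one_le_pow₀ hτ1), ?_, ?_⟩
  · refine natDegree_C_mul_le _ _ |>.trans ?_
    refine natDegree_comp_le.trans ?_
    rw [Chebyshev.natDegree_T, Int.natAbs_natCast]
    refine (Nat.mul_le_mul_left m (?_ : _ ≤ 1)).trans (mul_one m).le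
    compute_degree
  · simp [hT, hτ0.ne']
  · rintro t ⟨h1, h2⟩
    have h3 : |x₀ - 2 / (Γ - γ) * t| ≤ 1 := by
      have h4 : x₀ - 2 / (Γ - γ) * t = (Γ + γ - 2 * t) / (Γ - γ) := by rw [hx₀]; ring
      rw [h4, abs_le, le_div_iff₀ hd, div_le_iff₀ hd]
      constructor <;> linarith
    have h5 := Chebyshev.abs_eval_T_real_le_one (m : ℤ) h3
    simp only [eval_mul, eval_C, eval_comp, eval_sub, eval_X]
    rw [mul_pow, inv_pow]
    refine mul_le_of_le_one_right (by positivity) ?_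
    exact (sq_le_one_iff_abs_le_one _).2 h5
  · rw [chebRate, if_neg hκ.ne', ← hD]
    have h1 : D ^ (2 * m) = (D ^ m) ^ 2 := by rw [mul_comm, pow_mul]
    have h2 : 2 * τ ^ 2 - 1 = (D ^ (2 * m) + (D ^ (2 * m))⁻¹) / 2 := by
      rw [h1, hτ]
      field_simp
      ring
    have h3 : (τ ^ 2)⁻¹ / (2 - (τ ^ 2)⁻¹) = 1 / (2 * τ ^ 2 - 1) := by
      have h4 : 2 * τ ^ 2 - 1 ≠ 0 := by nlinarith
      have h5 : 2 - (τ ^ 2)⁻¹ = (2 * τ ^ 2 - 1) * (τ ^ 2)⁻¹ := by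
        field_simp
      rw [h5]
      field_simp
    rw [h3, h2, one_div_div]

/-! ### Asymptotic two-step estimate -/

section TwoStep

open Asymptotics Polynomial

variable {E : Type*} [NormedAddCommGroup E] [InnerProductSpace ℂ E]

/-- The operator pencil `-H + δ P + δ² A`: the expansion of `F(λ + δ)` around an eigenvalue `λ`. -/
noncomputable def opPencil (H P A : E →L[ℂ] E) (δ : ℝ) : E →L[ℂ] E :=
  -H + (δ : ℂ) • P + ((δ : ℂ) ^ 2) • A

theorem differentiable_aeval_neg_opPencil (H P A : E →L[ℂ] E) (q : ℝ[X]) :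
    Differentiable ℝ fun δ : ℝ => aeval (-(opPencil H P A δ)) q := by
  have h1 : Differentiable ℝ fun δ : ℝ => -(opPencil H P A δ) := by
    unfold opPencil
    have h2 : Differentiable ℝ fun δ : ℝ => (δ : ℂ) := Complex.ofRealCLM.differentiable
    fun_prop
  simp_rw [aeval_eq_sum_range]
  fun_prop

theorem inner_aeval_left {H : E →L[ℂ] E} (hH : ∀ x y, inner ℂ (H x) y = inner ℂ x (H y))
    (q : ℝ[X]) : ∀ x y, inner ℂ (aeval H q x) y = inner ℂ x (aeval H q y) := by
  induction q using Polynomial.induction_on' with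
  | add p q hp hq =>
    intro x y
    simp only [map_add, add_apply, inner_add_left, inner_add_right, hp, hq]
  | monomial k a =>
    have hpow : ∀ k x y, inner ℂ ((H ^ k) x) y = inner ℂ x ((H ^ k) y) := by
      intro k
      induction k with
      | zero => simp
      | succ k ih =>
        intro x y
        have hcomm : H ((H ^ k) y) = (H ^ k) (H y) :=
          congrArg (fun T : E →L[ℂ] E => T y) ((Commute.refl H).pow_right k).eq
        rw [pow_succ]
        change inner ℂ ((H ^ k) (H x)) y = inner ℂ x ((H ^ k) (H y))
        rw [ih, hH, hcomm]
    intro x y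
    rw [aeval_monomial, Algebra.algebraMap_eq_smul_one, smul_mul_assoc, one_mul,
      ← Complex.coe_smul, smul_apply, smul_apply,
      inner_smul_left, inner_smul_right, hpow, Complex.conj_ofReal]

theorem aeval_apply_of_apply_eq_zero {H : E →L[ℂ] E} {u : E} (hu : H u = 0) {q : ℝ[X]}
    (hq : q.eval 0 = 1) : aeval H q u = u := by
  conv_lhs => rw [← divX_mul_X_add q]
  rw [map_add, map_mul, aeval_X, aeval_C, coeff_zero_eq_eval_zero, hq, map_one]
  change aeval H (divX q) (H u) + u = u
  rw [hu, map_zero, zero_add]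

theorem Asymptotics.IsBigO.inner_complex {ι : Type*} {l : Filter ι} {f f' : ι → E} {g g' : ι → ℝ}
    (h : f =O[l] g) (h' : f' =O[l] g') :
    (fun i => inner ℂ (f i) (f' i)) =O[l] fun i => g i * g' i := by
  refine IsBigO.trans (isBigO_of_le l fun i => ?_) (h.norm_left.mul h'.norm_left)
  simpa using norm_inner_le_norm (𝕜 := ℂ) (f i) (f' i)

theorem Asymptotics.IsBigO.clm_apply_op {ι : Type*} {l : Filter ι} {f : ι → E →L[ℂ] E} {v : ι → E}
    {g g' : ι → ℝ} (h : f =O[l] g) (h' : v =O[l] g') :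
    (fun i => f i (v i)) =O[l] fun i => g i * g' i := by
  refine IsBigO.trans (isBigO_of_le l fun i => ?_) (h.norm_left.mul h'.norm_left)
  simpa using (f i).le_opNorm (v i)

/-- First order expansion of the perturbation part of the pencil at the vector `u`. -/
theorem isBigO_inner_perturbation {ι : Type*} {l : Filter ι} (P A : E →L[ℂ] E) (u : E)
    {r δ : ι → ℝ} (hr : Tendsto r l (𝓝 0)) (hδ : δ =O[l] fun i => r i ^ 2) {f : ι → E}
    (hf : f =O[l] r) :
    (fun i => inner ℂ (u + f i) (((δ i : ℂ) • P + ((δ i : ℂ) ^ 2) • A) (u + f i))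
      - (δ i : ℂ) * inner ℂ u (P u)) =O[l] fun i => r i ^ 3 := by
  have hr1 : r =O[l] fun _ => (1 : ℝ) := hr.isBigO_one ℝ
  have hu : (fun _ : ι => u) =O[l] fun _ => (1 : ℝ) := isBigO_const_const _ one_ne_zero _
  have hw : (fun i => u + f i) =O[l] fun _ => (1 : ℝ) := hu.add (hf.trans hr1)
  have hδc : (fun i => (δ i : ℂ)) =O[l] fun i => r i ^ 2 :=
    IsBigO.trans (isBigO_of_le l fun i => by simp) hδ
  have h1 : (fun i => inner ℂ u (P (f i))) =O[l] r := by
    simpa using hu.inner_complex ((P.isBigO_comp f l).trans hf)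
  have h2 : (fun i => inner ℂ (f i) (P (u + f i))) =O[l] r := by
    simpa using hf.inner_complex ((P.isBigO_comp _ l).trans hw)
  have h3 : (fun i => inner ℂ (u + f i) (A (u + f i))) =O[l] fun _ => (1 : ℝ) := by
    simpa using hw.inner_complex ((A.isBigO_comp _ l).trans hw)
  have h4 := hδc.mul (h1.add h2)
  have h5 := (hδc.pow 2).mul h3
  have h6 : (fun i => (r i ^ 2) ^ 2 * (1 : ℝ)) =O[l] fun i => r i ^ 3 := by
    have := (isBigO_refl (fun i => r i ^ 3) l).mul hr1
    refine (this.congr (fun i => ?_) fun i => ?_) <;> ring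
  have h7 : (fun i => r i ^ 2 * r i) =O[l] fun i => r i ^ 3 :=
    (isBigO_refl (fun i => r i ^ 3) l).congr_left fun i => by ring
  refine ((h4.trans h7).add (h5.trans h6)).congr_left fun i => ?_
  simp only [add_apply, smul_apply, inner_add_right,
    inner_smul_right, inner_add_left, map_add]
  ring

/-- Two consecutive steps of the method near a simple smallest eigenvalue, with unit
preconditioner, seen through the only properties that the estimate needs: the Galerkin condition
`orth` for the first step and the minimality `test` for the second one. -/
theorem two_step_estimate {ι : Type*} {l : Filter ι} {H P A : E →L[ℂ] E} {u : E}
    (hH : ∀ x y, inner ℂ (H x) y = inner ℂ x (H y)) (hHu : H u = 0)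
    (hν : 0 < (inner ℂ u (P u)).re) {p : ℝ[X]} {s : ℝ} (hp0 : p.eval 0 = 1) (hs1 : s ≤ 1)
    (hps : ∀ e, (inner ℂ (aeval H p e) (H (aeval H p e))).re ≤ s * (inner ℂ e (H e)).re)
    {δ₀ δ₁ δ₂ : ι → ℝ} {e₀ e₁ : ι → E} (hδ : Tendsto δ₀ l (𝓝 0)) (hδ₁ : ∀ i, 0 ≤ δ₁ i)
    (hδ₁₀ : ∀ i, δ₁ i ≤ δ₀ i) (hδ₂ : ∀ i, 0 ≤ δ₂ i) (hδ₂₁ : ∀ i, δ₂ i ≤ δ₁ i)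
    (he₀ : e₀ =O[l] fun i => √(δ₀ i)) (he₁ : e₁ =O[l] fun i => √(δ₀ i))
    (root₀ : ∀ i, inner ℂ (u + e₀ i) (opPencil H P A (δ₀ i) (u + e₀ i)) = 0)
    (root₁ : ∀ i, inner ℂ (u + e₁ i) (opPencil H P A (δ₁ i) (u + e₁ i)) = 0)
    (orth : ∀ i, inner ℂ (aeval (-(opPencil H P A (δ₀ i))) p (u + e₀ i))
      (opPencil H P A (δ₁ i) (u + e₁ i)) = 0)
    (test : ∀ i, ∀ a b : ℂ, ∀ w, w = a • aeval (-(opPencil H P A (δ₁ i))) p (u + e₁ i)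
      + b • (u + e₀ i) → (inner ℂ w (opPencil H P A (δ₂ i) w)).re ≤ 0) :
    ∃ M : ℝ, ∀ᶠ i in l, δ₂ i ≤ (s / (2 - s)) ^ 2 * δ₀ i + M * √(δ₀ i) ^ 3 := by
  set r : ι → ℝ := fun i => √(δ₀ i) with hrdef
  have hr : Tendsto r l (𝓝 0) := by
    have := (Real.continuous_sqrt.tendsto 0).comp hδ
    rwa [Real.sqrt_zero] at this
  have hδ₀ : ∀ i, δ₀ i = r i ^ 2 := fun i =>
    (Real.sq_sqrt ((hδ₁ i).trans (hδ₁₀ i))).symm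
  have hr1 : r =O[l] fun _ => (1 : ℝ) := hr.isBigO_one ℝ
  have hr21 : (fun i => r i ^ 2) =O[l] r :=
    ((isBigO_refl r l).mul hr1).congr (fun i => by ring) fun i => by ring
  have O₀ : δ₀ =O[l] fun i => r i ^ 2 := isBigO_of_le l fun i => by rw [hδ₀]
  have O₁ : δ₁ =O[l] fun i => r i ^ 2 := isBigO_of_le l fun i => by
    rw [← hδ₀, Real.norm_of_nonneg (hδ₁ i), Real.norm_of_nonneg ((hδ₁ i).trans (hδ₁₀ i))]
    exact hδ₁₀ i
  have O₂ : δ₂ =O[l] fun i => r i ^ 2 := IsBigO.trans (isBigO_of_le l fun i => by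
    rw [Real.norm_of_nonneg (hδ₁ i), Real.norm_of_nonneg (hδ₂ i)]
    exact hδ₂₁ i) O₁
  have hu : (fun _ : ι => u) =O[l] fun _ => (1 : ℝ) := isBigO_const_const _ one_ne_zero _
  have hx₀ : (fun i => u + e₀ i) =O[l] fun _ => (1 : ℝ) := hu.add (he₀.trans hr1)
  have hx₁ : (fun i => u + e₁ i) =O[l] fun _ => (1 : ℝ) := hu.add (he₁.trans hr1)
  have hHe₁ : (fun i => H (e₁ i)) =O[l] r := (H.isBigO_comp e₁ l).trans he₁
  -- The perturbation `F(λ + δ) - F(λ)`.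
  set D : ℝ → E →L[ℂ] E := fun δ => (δ : ℂ) • P + ((δ : ℂ) ^ 2) • A with hD
  have hpen : ∀ δ v, opPencil H P A δ v = -(H v) + D δ v := by
    intro δ v
    simp only [opPencil, hD, add_apply, neg_apply]
    abel
  have hD₁ : (fun i => D (δ₁ i)) =O[l] fun i => r i ^ 2 := by
    have hδc : (fun i => (δ₁ i : ℂ)) =O[l] fun i => r i ^ 2 :=
      IsBigO.trans (isBigO_of_le l fun i => by simp) O₁
    have h1 := hδc.smul (isBigO_const_const P (one_ne_zero' ℝ) l)
    have h2 := (hδc.pow 2).smul (isBigO_const_const A (one_ne_zero' ℝ) l)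
    have h3 : (fun i => (r i ^ 2) ^ 2 • (1 : ℝ)) =O[l] fun i => r i ^ 2 • (1 : ℝ) :=
      (((hr1.pow 2).mul (isBigO_refl (fun i => r i ^ 2) l))).congr
        (fun i => by simp only [smul_eq_mul]; ring) fun i => by simp
    exact (h1.add (h2.trans h3)).congr_right fun i => by simp
  -- The polynomial filter and its unperturbed version `G`.
  set G : E →L[ℂ] E := aeval H p with hG
  have hGu : G u = u := aeval_apply_of_apply_eq_zero hHu hp0
  set G' : ℝ → E →L[ℂ] E := fun δ => aeval (-(opPencil H P A δ)) p with hG'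
  have hG'0 : G' 0 = G := by simp [hG', hG, opPencil]
  have hGO : ∀ δ : ι → ℝ, δ =O[l] (fun i => r i ^ 2) →
      (fun i => G' (δ i) - G) =O[l] fun i => r i ^ 2 := by
    intro δ hδO
    have hδ0 : Tendsto δ l (𝓝 0) := hδO.trans_tendsto (by simpa using hr.pow 2)
    have h1 := ((differentiable_aeval_neg_opPencil H P A p) 0).isBigO_sub.comp_tendsto hδ0
    refine IsBigO.trans (h1.congr (fun i => ?_) fun i => ?_) hδO
    · simp only [Function.comp, ← hG'0, hG']
    · simp
  have hGsymm : ∀ x y, inner ℂ (G x) (H y) = inner ℂ x (H (G y)) := by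
    intro x y
    have hcomm : G (H y) = H (G y) := by
      have h1 : aeval H p * H = H * aeval H p := by
        simpa using congrArg (aeval H) (mul_comm p X)
      exact congrArg (fun T : E →L[ℂ] E => T y) h1
    rw [inner_aeval_left hH, ← hcomm]
  have herm : ∀ x y, (inner ℂ x (H y)).re = (inner ℂ y (H x)).re := by
    intro x y
    rw [← hH, ← inner_conj_symm, Complex.conj_re]
  -- The Rayleigh quotient of the first vector.
  have err₁ : (fun i => inner ℂ (e₀ i) (H (e₀ i)) - (δ₀ i : ℂ) * inner ℂ u (P u)) =O[l]
      fun i => r i ^ 3 := by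
    refine (isBigO_inner_perturbation P A u hr O₀ he₀).congr_left fun i => ?_
    have h1 := root₀ i
    rw [hpen, inner_add_right, inner_neg_right] at h1
    have h2 : inner ℂ (u + e₀ i) (H (u + e₀ i)) = inner ℂ (e₀ i) (H (e₀ i)) := by
      rw [map_add, hHu, zero_add, inner_add_left, ← hH u, hHu, inner_zero_left, zero_add]
    rw [h2] at h1
    linear_combination h1
  -- The Galerkin condition of the first step.
  have err₂ : (fun i => inner ℂ (G (e₀ i)) (H (e₁ i)) - inner ℂ (e₁ i) (H (e₁ i))) =O[l]
      fun i => r i ^ 3 := by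
    have h1 : (fun i => (G' (δ₀ i) - G) (u + e₀ i)) =O[l] fun i => r i ^ 2 := by
      simpa using (hGO δ₀ O₀).clm_apply_op hx₀
    have h2 : (fun i => (G' (δ₀ i) - G) (u + e₀ i) + (G (e₀ i) - e₁ i)) =O[l] r :=
      (h1.trans hr21).add (((G.isBigO_comp e₀ l).trans he₀).sub he₁)
    have h3 := h2.inner_complex (hD₁.clm_apply_op hx₁)
    have h4 := h1.inner_complex hHe₁
    have h5 := (h3.congr_right (g₂ := fun i => r i ^ 3) fun i => by ring).sub
      (h4.congr_right (g₂ := fun i => r i ^ 3) fun i => by ring)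
    refine h5.congr_left fun i => ?_
    have h6 := orth i
    have h7 := root₁ i
    have h8 : opPencil H P A (δ₁ i) (u + e₁ i) = -(H (e₁ i)) + D (δ₁ i) (u + e₁ i) := by
      rw [hpen, map_add H, hHu, zero_add]
    have h9 : aeval (-(opPencil H P A (δ₀ i))) p (u + e₀ i) =
        ((G' (δ₀ i) - G) (u + e₀ i) + (G (e₀ i) - e₁ i)) + (u + e₁ i) := by
      rw [sub_apply, map_add G, hGu]
      change G' (δ₀ i) (u + e₀ i) = _
      abel
    rw [h9, inner_add_left, h7, add_zero, h8, inner_add_right, inner_neg_right,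
      inner_add_left, inner_sub_left] at h6
    linear_combination h6
  -- With this weight the contributions of `e₁` cancel in the estimate below.
  set α : ℝ := 2 / (2 - s) with hα
  set f : ι → E := fun i => (α : ℂ) • G (e₁ i) + ((1 - α : ℝ) : ℂ) • e₀ i with hf
  set g : ι → E := fun i => (α : ℂ) • (G' (δ₁ i) - G) (u + e₁ i) with hg
  have hfO : f =O[l] r :=
    (((G.isBigO_comp e₁ l).trans he₁).const_smul_left _).add (he₀.const_smul_left _)
  have hgO : g =O[l] fun i => r i ^ 2 := by
    refine IsBigO.const_smul_left ?_ _
    simpa using (hGO δ₁ O₁).clm_apply_op hx₁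
  have hw : ∀ i, u + (f i + g i) = (α : ℂ) • aeval (-(opPencil H P A (δ₁ i))) p (u + e₁ i)
      + ((1 - α : ℝ) : ℂ) • (u + e₀ i) := by
    intro i
    change _ = (α : ℂ) • G' (δ₁ i) (u + e₁ i) + _
    simp only [hf, hg, sub_apply, map_add G, hGu]
    push_cast
    module
  have hfgO : (fun i => f i + g i) =O[l] r := hfO.add (hgO.trans hr21)
  have err₃ : (fun i => inner ℂ (u + (f i + g i)) (opPencil H P A (δ₂ i) (u + (f i + g i)))
      + inner ℂ (f i) (H (f i)) - (δ₂ i : ℂ) * inner ℂ u (P u)) =O[l] fun i => r i ^ 3 := by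
    have h1 := isBigO_inner_perturbation P A u hr O₂ hfgO
    have h2 := hgO.inner_complex ((H.isBigO_comp _ l).trans hfgO)
    have h3 := hfO.inner_complex ((H.isBigO_comp _ l).trans hgO)
    have h4 := (h1.sub (h2.congr_right (g₂ := fun i => r i ^ 3) fun i => by ring)).sub
      (h3.congr_right (g₂ := fun i => r i ^ 3) fun i => by ring)
    refine h4.congr_left fun i => ?_
    rw [hpen, map_add H u, hHu, zero_add, inner_add_right _ (-_), inner_neg_right,
      inner_add_left u _ (H _), ← hH u, hHu, inner_zero_left, zero_add, map_add H (f i),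
      inner_add_left (f i), inner_add_right (f i)]
    ring
  have hT := ((err₂.const_mul_left ((2 * α * (1 - α) : ℝ) : ℂ)).add
    (err₁.const_mul_left (((1 - α) ^ 2 : ℝ) : ℂ))).sub err₃
  obtain ⟨C, hC⟩ := hT.bound
  set ν := (inner ℂ u (P u)).re with hνdef
  refine ⟨C / ν, hC.mono fun i hi => ?_⟩
  have h1 := (Complex.re_le_norm _).trans hi
  have hri : 0 ≤ r i := Real.sqrt_nonneg _
  rw [Real.norm_of_nonneg (pow_nonneg hri 3)] at h1
  simp only [Complex.sub_re, Complex.add_re, Complex.re_ofReal_mul, ← hνdef] at h1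
  have h2 := test i _ _ _ (hw i)
  have h3 : (inner ℂ (f i) (H (f i))).re =
      α ^ 2 * (inner ℂ (G (e₁ i)) (H (G (e₁ i)))).re
        + 2 * α * (1 - α) * (inner ℂ (G (e₀ i)) (H (e₁ i))).re
        + (1 - α) ^ 2 * (inner ℂ (e₀ i) (H (e₀ i))).re := by
    have h4 : (inner ℂ (G (e₁ i)) (H (e₀ i))).re = (inner ℂ (G (e₀ i)) (H (e₁ i))).re := by
      rw [herm, hGsymm]
    simp only [hf, map_add, map_smul, inner_add_left, inner_add_right, inner_smul_left,
      inner_smul_right, Complex.conj_ofReal, Complex.add_re, Complex.re_ofReal_mul]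
    rw [← hGsymm (e₀ i), h4]
    ring
  have h5 := mul_le_mul_of_nonneg_left (hps (e₁ i)) (sq_nonneg α)
  have hs2 : 2 - s ≠ 0 := by linarith
  have h6 : α ^ 2 * s + 2 * α * (1 - α) = 0 := by rw [hα]; field_simp; ring
  have h7 : (1 - α) ^ 2 = (s / (2 - s)) ^ 2 := by rw [hα]; field_simp; ring
  have h8 : α ^ 2 * (s * (inner ℂ (e₁ i) (H (e₁ i))).re) +
      2 * α * (1 - α) * (inner ℂ (e₁ i) (H (e₁ i))).re = 0 := by
    linear_combination (inner ℂ (e₁ i) (H (e₁ i))).re * h6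
  have h9 : δ₂ i * ν ≤ (s / (2 - s)) ^ 2 * δ₀ i * ν + C * r i ^ 3 := by
    rw [← h7]
    linarith
  have h10 : C / ν * r i ^ 3 * ν = C * r i ^ 3 := by
    field_simp
  refine le_of_mul_le_mul_right ?_ hν
  rw [add_mul, h10]
  exact h9

end TwoStep

/-! ### Uniform two-step estimate -/

section UniformEstimate

open Asymptotics Polynomial

variable {E : Type*} [NormedAddCommGroup E] [InnerProductSpace ℂ E]

/-- Near the simple smallest eigenvalue, a vector with Rayleigh quotient `λ + δ` is, up to scaling,
`u + e` with an error `e` of order `√δ`. -/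
theorem exists_splitting {H P A : E →L[ℂ] E} {u : E} (hu : ‖u‖ = 1)
    (hH : ∀ x y, inner ℂ (H x) y = inner ℂ x (H y)) (hHu : H u = 0) {c : ℝ} (hc : 0 < c)
    (hcoer : ∀ f, inner ℂ u f = 0 → c * ‖f‖ ^ 2 ≤ (inner ℂ f (H f)).re) :
    ∃ ε > (0 : ℝ), ∃ M : ℝ, ∀ δ, 0 ≤ δ → δ ≤ ε → ∀ x, x ≠ 0 →
      inner ℂ x (opPencil H P A δ x) = 0 → ∃ a : ℂ, a ≠ 0 ∧ ∃ e, x = a • (u + e) ∧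
        ‖e‖ ≤ M * √δ := by
  set L : ℝ := ‖P‖ + ‖A‖ + 1 with hL
  have hL0 : 0 < L := by positivity
  refine ⟨min 1 (c / (2 * L)), by positivity, √(2 * L / c), fun δ hδ0 hδ x hx hroot => ?_⟩
  have hδ1 : δ ≤ 1 := hδ.trans (min_le_left _ _)
  have hδL : δ * L ≤ c / 2 := by
    have := (le_div_iff₀ (by positivity : 0 < 2 * L)).1 (hδ.trans (min_le_right _ _))
    linarith
  set a : ℂ := inner ℂ u x with ha
  set f : E := x - a • u with hf
  have hxf : x = a • u + f := by simp [hf]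
  have huu : inner ℂ u u = (1 : ℂ) := by rw [inner_self_eq_norm_sq_to_K, hu]; simp
  have huf : inner ℂ u f = 0 := by
    rw [hf, inner_sub_right, inner_smul_right, huu, ← ha]; simp
  have hnorm : ‖x‖ ^ 2 = ‖a‖ ^ 2 + ‖f‖ ^ 2 := by
    have := norm_add_sq_eq_norm_sq_add_norm_sq_of_inner_eq_zero (𝕜 := ℂ) (a • u) f
      (by rw [inner_smul_left, huf, mul_zero])
    rw [← hxf, norm_smul, hu, mul_one] at this
    nlinarith
  have hquad : (inner ℂ f (H f)).re ≤ δ * L * ‖x‖ ^ 2 := by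
    have h1 : inner ℂ f (H f) =
        (δ : ℂ) * inner ℂ x (P x) + ((δ ^ 2 : ℝ) : ℂ) * inner ℂ x (A x) := by
      have h2 : inner ℂ x (H x) = inner ℂ f (H f) := by
        rw [hxf, map_add, map_smul, hHu, smul_zero, zero_add, inner_add_left, inner_smul_left,
          ← hH u, hHu, inner_zero_left, mul_zero, zero_add]
      simp only [opPencil, add_apply, neg_apply, smul_apply, inner_add_right, inner_neg_right,
        inner_smul_right] at hroot
      rw [← h2]
      push_cast
      linear_combination -hroot
    have hb : ∀ Q : E →L[ℂ] E, (inner ℂ x (Q x)).re ≤ ‖Q‖ * ‖x‖ ^ 2 := by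
      intro Q
      calc (inner ℂ x (Q x)).re ≤ ‖inner ℂ x (Q x)‖ := Complex.re_le_norm _
        _ ≤ ‖x‖ * ‖Q x‖ := norm_inner_le_norm _ _
        _ ≤ ‖x‖ * (‖Q‖ * ‖x‖) := by gcongr; exact Q.le_opNorm x
        _ = _ := by ring
    rw [h1, Complex.add_re, Complex.re_ofReal_mul, Complex.re_ofReal_mul]
    have h3 := mul_le_mul_of_nonneg_left (hb P) hδ0
    have h4 := mul_le_mul_of_nonneg_left (hb A) (sq_nonneg δ)
    have h5 : δ ^ 2 * (‖A‖ * ‖x‖ ^ 2) ≤ δ * (‖A‖ * ‖x‖ ^ 2) := by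
      gcongr
      nlinarith
    have h6 : 0 ≤ δ * ‖x‖ ^ 2 := by positivity
    rw [hL]
    linarith
  have hkey : c / 2 * ‖f‖ ^ 2 ≤ δ * L * ‖a‖ ^ 2 := by
    have h1 := (hcoer f huf).trans hquad
    rw [hnorm] at h1
    have h2 := mul_le_mul_of_nonneg_right hδL (sq_nonneg ‖f‖)
    linarith
  have ha0 : a ≠ 0 := by
    intro h0
    rw [h0, norm_zero] at hkey
    have h1 : ‖f‖ ^ 2 ≤ 0 := by nlinarith
    have h2 : f = 0 := by
      rw [← norm_eq_zero]
      exact pow_eq_zero_iff two_ne_zero |>.1 (le_antisymm h1 (sq_nonneg _))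
    exact hx (by rw [hxf, h0, h2, zero_smul, add_zero])
  refine ⟨a, ha0, a⁻¹ • f, ?_, ?_⟩
  · rw [smul_add, smul_inv_smul₀ ha0]
    exact hxf
  · rw [← Real.sqrt_mul (by positivity)]
    refine Real.le_sqrt_of_sq_le ?_
    have han : 0 < ‖a‖ := norm_pos_iff.2 ha0
    rw [norm_smul, norm_inv, mul_pow, inv_pow, inv_mul_le_iff₀ (by positivity)]
    have h1 : ‖a‖ ^ 2 * (2 * L / c * δ) = δ * L * ‖a‖ ^ 2 * (2 / c) := by ring
    have h2 : ‖f‖ ^ 2 = c / 2 * ‖f‖ ^ 2 * (2 / c) := by field_simp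
    rw [h1, h2]
    gcongr

/-- The data of two consecutive steps of the method with unit preconditioner, for the pencil
`-H + δ P + δ² A`: two iterates `x₀`, `x₁` with Rayleigh quotients `δ₀`, `δ₁`, the Galerkin
condition for `x₁` against the filtered vector `p(-F(δ₀)) x₀`, and the minimality of `δ₂` on the
span of `p(-F(δ₁)) x₁` and `x₀`. -/
structure IsTwoStep (H P A : E →L[ℂ] E) (p : ℝ[X]) (δ₀ δ₁ δ₂ : ℝ) (x₀ x₁ : E) : Prop where
  ne₀ : x₀ ≠ 0
  ne₁ : x₁ ≠ 0
  nonneg₁ : 0 ≤ δ₁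
  nonneg₂ : 0 ≤ δ₂
  le₁₀ : δ₁ ≤ δ₀
  le₂₁ : δ₂ ≤ δ₁
  root₀ : inner ℂ x₀ (opPencil H P A δ₀ x₀) = 0
  root₁ : inner ℂ x₁ (opPencil H P A δ₁ x₁) = 0
  orth : inner ℂ (aeval (-(opPencil H P A δ₀)) p x₀) (opPencil H P A δ₁ x₁) = 0
  test : ∀ a b : ℂ, (inner ℂ (a • aeval (-(opPencil H P A δ₁)) p x₁ + b • x₀)
    (opPencil H P A δ₂ (a • aeval (-(opPencil H P A δ₁)) p x₁ + b • x₀))).re ≤ 0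

/-- The two-step estimate with constants independent of the iterates: the asymptotic estimate is
applied to the filter of all admissible data with `δ₀ → 0`. -/
theorem exists_uniform_two_step {H P A : E →L[ℂ] E} {u : E} (hu : ‖u‖ = 1)
    (hH : ∀ x y, inner ℂ (H x) y = inner ℂ x (H y)) (hHu : H u = 0) {c : ℝ} (hc : 0 < c)
    (hcoer : ∀ f, inner ℂ u f = 0 → c * ‖f‖ ^ 2 ≤ (inner ℂ f (H f)).re)
    (hν : 0 < (inner ℂ u (P u)).re) {p : ℝ[X]} {s : ℝ} (hp0 : p.eval 0 = 1) (hs1 : s ≤ 1)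
    (hps : ∀ e, (inner ℂ (aeval H p e) (H (aeval H p e))).re ≤ s * (inner ℂ e (H e)).re) :
    ∃ ε > (0 : ℝ), ∃ M : ℝ, ∀ δ₀ δ₁ δ₂ x₀ x₁, IsTwoStep H P A p δ₀ δ₁ δ₂ x₀ x₁ → δ₀ < ε →
      δ₂ ≤ (s / (2 - s)) ^ 2 * δ₀ + M * √δ₀ ^ 3 := by
  obtain ⟨ε₁, hε₁, N, hN⟩ := exists_splitting (P := P) (A := A) hu hH hHu hc hcoer
  let S : Type _ := {t : ℝ × ℝ × ℝ × E × E //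
    IsTwoStep H P A p t.1 t.2.1 t.2.2.1 t.2.2.2.1 t.2.2.2.2 ∧ t.1 ≤ ε₁}
  have hsplit₀ : ∀ t : S, ∃ a : ℂ, a ≠ 0 ∧ ∃ e, t.1.2.2.2.1 = a • (u + e) ∧
      ‖e‖ ≤ N * √t.1.1 := fun t =>
    hN t.1.1 (t.2.1.nonneg₁.trans t.2.1.le₁₀) t.2.2 _ t.2.1.ne₀ t.2.1.root₀
  have hsplit₁ : ∀ t : S, ∃ a : ℂ, a ≠ 0 ∧ ∃ e, t.1.2.2.2.2 = a • (u + e) ∧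
      ‖e‖ ≤ N * √t.1.2.1 := fun t =>
    hN t.1.2.1 t.2.1.nonneg₁ (t.2.1.le₁₀.trans t.2.2) _ t.2.1.ne₁ t.2.1.root₁
  choose a₀ ha₀ e₀ hx₀ he₀ using hsplit₀
  choose a₁ ha₁ e₁ hx₁ he₁ using hsplit₁
  set l : Filter S := comap (fun t : S => t.1.1) (𝓝 0)
  have hroot : ∀ (Q : E →L[ℂ] E) (a : ℂ) (v : E), a ≠ 0 → inner ℂ (a • v) (Q (a • v)) = 0 →
      inner ℂ v (Q v) = 0 := by
    intro Q a v ha h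
    rw [map_smul, inner_smul_left, inner_smul_right] at h
    simpa [ha] using h
  obtain ⟨M, hM⟩ := two_step_estimate (l := l) (δ₀ := fun t => t.1.1) (δ₁ := fun t => t.1.2.1)
    (δ₂ := fun t => t.1.2.2.1) (P := P) (A := A) (e₀ := e₀) (e₁ := e₁) hH hHu hν hp0 hs1 hps
    tendsto_comap (fun t => t.2.1.nonneg₁) (fun t => t.2.1.le₁₀) (fun t => t.2.1.nonneg₂)
    (fun t => t.2.1.le₂₁)
    (IsBigO.of_bound N (Eventually.of_forall fun t => by
      rw [Real.norm_of_nonneg (Real.sqrt_nonneg _)]; exact he₀ t))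
    (IsBigO.of_bound |N| (Eventually.of_forall fun t => by
      rw [Real.norm_of_nonneg (Real.sqrt_nonneg _)]
      refine (he₁ t).trans ?_
      gcongr
      · exact le_abs_self N
      · exact t.2.1.le₁₀))
    (fun t => hroot _ (a₀ t) _ (ha₀ t) (by rw [← hx₀]; exact t.2.1.root₀))
    (fun t => hroot _ (a₁ t) _ (ha₁ t) (by rw [← hx₁]; exact t.2.1.root₁))
    (fun t => by
      have := t.2.1.orth
      rw [hx₀, hx₁, map_smul, map_smul, inner_smul_left, inner_smul_right] at this
      simpa only [mul_eq_zero, map_eq_zero, ha₀ t, ha₁ t, false_or] using this)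
    (fun t a b w hw => by
      have := t.2.1.test (a / a₁ t) (b / a₀ t)
      rw [hx₀, hx₁, map_smul, smul_smul, smul_smul, div_mul_cancel₀ _ (ha₁ t),
        div_mul_cancel₀ _ (ha₀ t), ← hw] at this
      exact this)
  obtain ⟨ε₂, hε₂, hball⟩ := Metric.eventually_nhds_iff.1 (eventually_comap.1 hM)
  refine ⟨min ε₁ ε₂, lt_min hε₁ hε₂, M, fun δ₀ δ₁ δ₂ x₀ x₁ h hδ => ?_⟩
  have h0 : 0 ≤ δ₀ := h.nonneg₁.trans h.le₁₀
  refine hball (y := δ₀) ?_ ⟨(δ₀, δ₁, δ₂, x₀, x₁), h, hδ.le.trans (min_le_left _ _)⟩ rfl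
  rw [Real.dist_eq, sub_zero, abs_of_nonneg h0]
  exact hδ.trans_le (min_le_right _ _)

variable [FiniteDimensional ℂ E]

/-- A polynomial bound on the spectrum bounds the polynomial in the energy seminorm of `H`. -/
theorem re_inner_aeval_le {H : E →L[ℂ] E} (hH : ∀ x y, inner ℂ (H x) y = inner ℂ x (H y))
    {p : ℝ[X]} {s : ℝ}
    (hspec : ∀ (t : ℝ) (e : E), e ≠ 0 → H e = (t : ℂ) • e → 0 ≤ t * (s - p.eval t ^ 2)) (e : E) :
    (inner ℂ (aeval H p e) (H (aeval H p e))).re ≤ s * (inner ℂ e (H e)).re := by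
  have : CompleteSpace E := FiniteDimensional.complete ℂ E
  have hsa : IsSelfAdjoint H :=
    ContinuousLinearMap.isSelfAdjoint_iff_isSymmetric.2 hH
  have hpos : 0 ≤ aeval H (X * (C s - p ^ 2)) := by
    rw [← cfc_polynomial _ H hsa]
    refine cfc_nonneg fun t ht => ?_
    have h1 : (t : ℂ) ∈ spectrum ℂ H := (spectrum.algebraMap_mem_iff ℂ).2 ht
    have h2 : (t : ℂ) ∈ spectrum ℂ (H : Module.End ℂ E) := by
      rw [← AlgEquiv.spectrum_eq (Module.End.toContinuousLinearMap E)]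
      exact h1
    obtain ⟨v, hv⟩ := (Module.End.hasEigenvalue_iff_mem_spectrum.2 h2).exists_hasEigenvector
    have h3 := hspec t v hv.2 hv.apply_eq_smul
    simpa using h3
  have h1 := ((ContinuousLinearMap.nonneg_iff_isPositive _).1 hpos).re_inner_nonneg_right e
  have h2 : inner ℂ e (aeval H (X * (C s - p ^ 2)) e) =
      (s : ℂ) * inner ℂ e (H e) - inner ℂ (aeval H p e) (H (aeval H p e)) := by
    have h3 : X * (C s - p ^ 2) = C s * X - p * (X * p) := by ring
    have h4 : aeval H (C s * X - p * (X * p)) e =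
        (s : ℂ) • H e - aeval H p (H (aeval H p e)) := by
      rw [map_sub, map_mul, map_mul, map_mul, aeval_C, aeval_X, sub_apply]
      congr 1
    rw [h3, h4, inner_sub_right, inner_smul_right, inner_aeval_left hH]
  rw [h2] at h1
  simp only [RCLike.re_to_complex, Complex.sub_re, Complex.re_ofReal_mul] at h1
  linarith

/-- A positive semidefinite operator whose kernel is spanned by `u` is coercive on `uᗮ`. -/
theorem exists_coercive {H : E →L[ℂ] E} {u : E} (hu : u ≠ 0)
    (hpos : ∀ f, 0 ≤ (inner ℂ f (H f)).re)
    (hker : ∀ f, (inner ℂ f (H f)).re = 0 → ∃ a : ℂ, f = a • u) :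
    ∃ c > (0 : ℝ), ∀ f, inner ℂ u f = 0 → c * ‖f‖ ^ 2 ≤ (inner ℂ f (H f)).re := by
  have : ProperSpace E := FiniteDimensional.proper ℂ E
  have hcont : Continuous fun f : E => (inner ℂ f (H f)).re :=
    Complex.continuous_re.comp (continuous_id.inner H.continuous)
  have hK : IsCompact (Metric.sphere (0 : E) 1 ∩ {f | inner ℂ u f = 0}) :=
    (isCompact_sphere _ _).inter_right
      (isClosed_eq (continuous_const.inner continuous_id) continuous_const)
  have hscale : ∀ f : E, f ≠ 0 → inner ℂ u f = 0 → ((‖f‖⁻¹ : ℝ) : ℂ) • f ∈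
      Metric.sphere (0 : E) 1 ∩ {f | inner ℂ u f = 0} := by
    intro f hf huf
    refine ⟨by simp [norm_smul, hf], ?_⟩
    change inner ℂ u _ = 0
    rw [inner_smul_right, huf, mul_zero]
  rcases Set.eq_empty_or_nonempty (Metric.sphere (0 : E) 1 ∩ {f | inner ℂ u f = 0}) with h0 | hne
  · refine ⟨1, one_pos, fun f huf => ?_⟩
    rcases eq_or_ne f 0 with rfl | hf
    · simp
    · exact absurd (hscale f hf huf) (by rw [h0]; simp)
  · obtain ⟨g, ⟨hg1, hg2⟩, hmin⟩ := hK.exists_isMinOn hne hcont.continuousOn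
    refine ⟨(inner ℂ g (H g)).re, ?_, fun f huf => ?_⟩
    · refine lt_of_le_of_ne (hpos g) fun h => ?_
      obtain ⟨a, rfl⟩ := hker g h.symm
      have ha : inner ℂ u (a • u) = 0 := hg2
      rw [inner_smul_right, mul_eq_zero] at ha
      rcases ha with rfl | ha
      · simp at hg1
      · exact hu (inner_self_eq_zero.1 ha)
    · rcases eq_or_ne f 0 with rfl | hf
      · simp
      · have h1 := hmin (hscale f hf huf)
        have h2 : (inner ℂ (((‖f‖⁻¹ : ℝ) : ℂ) • f) (H (((‖f‖⁻¹ : ℝ) : ℂ) • f))).re =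
            (‖f‖⁻¹) ^ 2 * (inner ℂ f (H f)).re := by
          rw [map_smul, inner_smul_left, inner_smul_right, Complex.conj_ofReal,
            Complex.re_ofReal_mul, Complex.re_ofReal_mul]
          ring
        have h3 : (inner ℂ g (H g)).re ≤ (‖f‖⁻¹) ^ 2 * (inner ℂ f (H f)).re := by
          rw [← h2]; exact h1
        have hf0 : 0 < ‖f‖ := norm_pos_iff.2 hf
        rw [inv_pow, ← div_eq_inv_mul, le_div_iff₀ (by positivity)] at h3
        exact h3

end UniformEstimate

/-! ### Congruence by the square root of the preconditioner -/

section Congruence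

open Polynomial

theorem aeval_apply_eq_sum {E : Type*} [NormedAddCommGroup E] [InnerProductSpace ℂ E]
    (f : E →L[ℂ] E) {q : ℝ[X]} {m : ℕ} (hq : q.natDegree ≤ m) (e : E) :
    aeval f q e = ∑ j ∈ Finset.range (m + 1), (q.coeff j : ℂ) • (f ^ j) e := by
  rw [aeval_eq_sum_range' (Nat.lt_succ_of_le hq), sum_apply]
  refine Finset.sum_congr rfl fun j _ => ?_
  rw [← Complex.coe_smul, smul_apply]

variable {n : ℕ}

/-- The operator of the congruent matrix `T M T` on Euclidean space; with `T = K^{1/2}` it turns the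
preconditioner `K` into the identity. -/
noncomputable def congrOp (T M : Matrix (Fin n) (Fin n) ℂ) :
    EuclideanSpace ℂ (Fin n) →L[ℂ] EuclideanSpace ℂ (Fin n) :=
  Matrix.toEuclideanCLM (n := Fin n) (𝕜 := ℂ) (T * M * T)

/-- The change of variables `e ↦ T e` that goes with `congrOp`. -/
noncomputable def congrVec (T : Matrix (Fin n) (Fin n) ℂ) :
    EuclideanSpace ℂ (Fin n) →ₗ[ℂ] (Fin n → ℂ) :=
  T.mulVecLin ∘ₗ (WithLp.linearEquiv 2 ℂ (Fin n → ℂ)).toLinearMap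

theorem congrVec_apply (T : Matrix (Fin n) (Fin n) ℂ) (e : EuclideanSpace ℂ (Fin n)) :
    congrVec T e = T.mulVec (WithLp.ofLp e) := rfl

theorem congrOp_apply (T M : Matrix (Fin n) (Fin n) ℂ) (e : EuclideanSpace ℂ (Fin n)) :
    congrOp T M e = WithLp.toLp 2 (T.mulVec (M.mulVec (congrVec T e))) := by
  rw [congrVec_apply, Matrix.mulVec_mulVec, Matrix.mulVec_mulVec]
  rfl

theorem inner_congrOp {T : Matrix (Fin n) (Fin n) ℂ} (hT : T.IsHermitian)
    (M : Matrix (Fin n) (Fin n) ℂ) (e e' : EuclideanSpace ℂ (Fin n)) :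
    inner ℂ e (congrOp T M e') = star (congrVec T e) ⬝ᵥ M.mulVec (congrVec T e') := by
  rw [congrOp_apply, EuclideanSpace.inner_eq_star_dotProduct, dotProduct_comm, congrVec_apply T e,
    Matrix.star_mulVec, hT.eq, ← Matrix.dotProduct_mulVec]

theorem inner_congrOp_left {T M : Matrix (Fin n) (Fin n) ℂ} (hT : T.IsHermitian)
    (hM : M.IsHermitian) (e e' : EuclideanSpace ℂ (Fin n)) :
    inner ℂ (congrOp T M e) e' = inner ℂ e (congrOp T M e') := by
  rw [← inner_conj_symm, inner_congrOp hT, inner_congrOp hT, ← RCLike.star_def,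
    ← Matrix.star_dotProduct_star, star_star, Matrix.star_mulVec, hM.eq,
    ← Matrix.dotProduct_mulVec]

theorem congrVec_congrOp {T K : Matrix (Fin n) (Fin n) ℂ} (hTK : T * T = K)
    (M : Matrix (Fin n) (Fin n) ℂ) (e : EuclideanSpace ℂ (Fin n)) :
    congrVec T (congrOp T M e) = (K * M).mulVec (congrVec T e) := by
  rw [congrOp_apply, congrVec_apply T (WithLp.toLp 2 _), Matrix.mulVec_mulVec,
    Matrix.mulVec_mulVec, hTK]

theorem congrVec_congrOp_pow {T K : Matrix (Fin n) (Fin n) ℂ} (hTK : T * T = K)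
    (M : Matrix (Fin n) (Fin n) ℂ) (j : ℕ) (e : EuclideanSpace ℂ (Fin n)) :
    congrVec T ((congrOp T M ^ j) e) = ((K * M) ^ j).mulVec (congrVec T e) := by
  induction j generalizing e with
  | zero => simp
  | succ j ih =>
    rw [pow_succ, pow_succ, ← Matrix.mulVec_mulVec, ← congrVec_congrOp hTK, ← ih]
    rfl

theorem congrVec_aeval_mem {T K M : Matrix (Fin n) (Fin n) ℂ} (hTK : T * T = K) {m : ℕ}
    {q : ℝ[X]} (hq : q.natDegree ≤ m) {e : EuclideanSpace ℂ (Fin n)}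
    {S : Submodule ℂ (Fin n → ℂ)}
    (hS : ∀ j ≤ m, ((K * M) ^ j).mulVec (congrVec T e) ∈ S) :
    congrVec T (aeval (-(congrOp T M)) q e) ∈ S := by
  change aeval (-(congrOp T M)) q e ∈ S.comap (congrVec T)
  rw [aeval_apply_eq_sum _ hq]
  refine Submodule.sum_mem _ fun j hj => Submodule.smul_mem _ _ ?_
  have h1 : (congrOp T M ^ j) e ∈ S.comap (congrVec T) := by
    rw [Submodule.mem_comap, congrVec_congrOp_pow hTK]
    exact hS j (Nat.lt_succ_iff.1 (Finset.mem_range.1 hj))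
  rcases j.even_or_odd with hj' | hj'
  · rwa [hj'.neg_pow]
  · rw [hj'.neg_pow, neg_apply]
    exact Submodule.neg_mem _ h1

theorem opPencil_congrOp (T A B C : Matrix (Fin n) (Fin n) ℂ) (t δ : ℝ) :
    opPencil (congrOp T (-(quadF A B C t))) (congrOp T (quadF' A B t)) (congrOp T A) δ =
      congrOp T (quadF A B C (t + δ)) := by
  rw [quadF_add]
  simp only [opPencil, congrOp, ← map_neg, ← map_smul, ← map_add]
  congr 1
  simp [Matrix.mul_add, Matrix.add_mul]

end Congruence

/-- At an eigenvalue `t > lam0` the form `xᴴ F'(t) x` is positive on eigenvectors: `xᴴ F x` is a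
convex quadratic that vanishes at `t` and is negative at `lam0 < t`. -/
theorem re_quadF'_pos {n : ℕ} {A B C : Matrix (Fin n) (Fin n) ℂ} {lam0 t : ℝ} (hA : A.PosDef)
    (hF : (-(quadF A B C lam0)).PosDef) (ht : lam0 < t) {u : Fin n → ℂ} (hu : u ≠ 0)
    (hFu : (quadF A B C t).mulVec u = 0) :
    0 < (star u ⬝ᵥ (quadF' A B t).mulVec u).re := by
  have ha := (Complex.pos_iff.1 (hA.dotProduct_mulVec_pos hu)).1
  have h0 := (Complex.pos_iff.1 (hF.dotProduct_mulVec_pos hu)).1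
  have h1 : quadF A B C lam0 = quadF A B C (t + (lam0 - t)) := by congr 1; ring
  rw [h1, quadF_add] at h0
  simp only [Matrix.neg_mulVec, Matrix.add_mulVec, Matrix.smul_mulVec, dotProduct_neg,
    dotProduct_add, dotProduct_smul, hFu, zero_add, smul_eq_mul, Complex.neg_re,
    Complex.add_re, ← Complex.ofReal_pow, Complex.re_ofReal_mul] at h0
  have h2 : 0 < t - lam0 := sub_pos.2 ht
  have h3 : 0 < (t - lam0) ^ 2 * (star u ⬝ᵥ A.mulVec u).re := by positivity
  refine pos_of_mul_pos_right (a := t - lam0) ?_ h2.le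
  nlinarith

/-- The two-step rate, with constants that do not depend on the iterates. -/
theorem exists_rate_constants {n : ℕ} {A B C K : Matrix (Fin n) (Fin n) ℂ} {lam0 t : ℝ}
    (hA : A.PosDef) (hB : B.IsHermitian) (hC : C.IsHermitian)
    (hF : (-(quadF A B C lam0)).PosDef) (hK : K.PosDef) {m : ℕ} (hm : 1 ≤ m) {u : Fin n → ℂ}
    (hmin : IsMinEigenpair (quadF A B C) lam0 t u)
    (hker : ∀ v, (quadF A B C t).mulVec v = 0 → ∃ c : ℂ, v = c • u) {γ Γ : ℝ}
    (hγ : IsLeast (positiveEigenvalues (-(K * quadF A B C t))) γ)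
    (hΓ : IsGreatest (positiveEigenvalues (-(K * quadF A B C t))) Γ) :
    ∃ ε > (0 : ℝ), ∃ M : ℝ, ∀ (ρ : ℕ → ℝ) (x : ℕ → Fin n → ℂ) (d : ℕ → ℕ)
      (Z : (i : ℕ) → Matrix (Fin n) (Fin (d i)) ℂ) (y : (i : ℕ) → Fin (d i) → ℂ),
      IsLOCG A B C lam0 m (fun _ => K) ρ x d Z y → (∀ i, t ≤ ρ i) → ∀ i, ρ i - t < ε →
        ρ (i + 2) - t ≤ chebRate (Γ / γ) m ^ 2 * (ρ i - t) + M * √(ρ i - t) ^ 3 := by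
  have hFH := quadF_isHermitian hA.isHermitian hB hC
  set T := CFC.sqrt K with hTdef
  have hTK : T * T = K := CFC.sqrt_mul_sqrt_self K hK.posSemidef.nonneg
  have hT : T.IsHermitian :=
    (Matrix.nonneg_iff_posSemidef.1 (CFC.sqrt_nonneg K)).isHermitian
  have hTu : IsUnit T := by
    rw [Matrix.isUnit_iff_isUnit_det]
    have h1 := (Matrix.isUnit_iff_isUnit_det _).1 hK.isUnit
    rw [← hTK, Matrix.det_mul] at h1
    exact isUnit_of_mul_isUnit_left h1
  have hTdet := (Matrix.isUnit_iff_isUnit_det _).1 hTu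
  have hinj : ∀ e, congrVec T e = 0 → e = 0 := by
    intro e he
    have h1 : WithLp.ofLp e = 0 := Matrix.mulVec_injective_iff_isUnit.2 hTu (by
      rw [← congrVec_apply, he, Matrix.mulVec_zero])
    exact WithLp.ofLp_injective 2 h1
  have hlift : ∀ v, ∃ e, congrVec T e = v := fun v => ⟨WithLp.toLp 2 (T⁻¹.mulVec v), by
    rw [congrVec_apply, Matrix.mulVec_mulVec, Matrix.mul_nonsing_inv _ hTdet, Matrix.one_mulVec]⟩
  have hpsd := hmin.posSemidef_neg (continuous_quadF A B C) hFH hF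
  obtain ⟨hlt, hu, hFu, -⟩ := hmin
  -- The eigenvector in the new coordinates, with unit length.
  obtain ⟨u₁, hu₁⟩ := hlift u
  have hu₁0 : u₁ ≠ 0 := by
    rintro rfl
    exact hu (by rw [← hu₁, map_zero])
  set u₂ := ((‖u₁‖⁻¹ : ℝ) : ℂ) • u₁ with hu₂
  have hs0 : ((‖u₁‖⁻¹ : ℝ) : ℂ) ≠ 0 := by simpa using hu₁0
  have hu₂n : ‖u₂‖ = 1 := by simp [hu₂, norm_smul, hu₁0]
  have hu₂v : congrVec T u₂ = ((‖u₁‖⁻¹ : ℝ) : ℂ) • u := by rw [hu₂, map_smul, hu₁]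
  have hu₂0 : congrVec T u₂ ≠ 0 := by rw [hu₂v]; exact smul_ne_zero hs0 hu
  have hFu₂ : (quadF A B C t).mulVec (congrVec T u₂) = 0 := by
    rw [hu₂v, Matrix.mulVec_smul, hFu, smul_zero]
  set H := congrOp T (-(quadF A B C t)) with hH
  have hHsymm := inner_congrOp_left hT (hFH t).neg
  have hHu : H u₂ = 0 := by
    rw [hH, congrOp_apply, Matrix.neg_mulVec, hFu₂, neg_zero, Matrix.mulVec_zero, WithLp.toLp_zero]
  have hHpos : ∀ f, 0 ≤ (inner ℂ f (H f)).re := fun f => by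
    rw [hH, inner_congrOp hT]
    exact (Complex.nonneg_iff.1 (hpsd.dotProduct_mulVec_nonneg _)).1
  have hHker : ∀ f, (inner ℂ f (H f)).re = 0 → ∃ a : ℂ, f = a • u₂ := by
    intro f hf
    rw [hH, inner_congrOp hT] at hf
    have h1 := (hpsd.dotProduct_mulVec_zero_iff (congrVec T f)).1
      (Complex.ext hf ((hFH t).neg.im_star_dotProduct_mulVec_self _))
    rw [Matrix.neg_mulVec, neg_eq_zero] at h1
    obtain ⟨b, hb⟩ := hker _ h1
    refine ⟨b * (((‖u₁‖⁻¹ : ℝ) : ℂ))⁻¹, sub_eq_zero.1 (hinj _ ?_)⟩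
    rw [map_sub, map_smul, hu₂v, hb, smul_smul, inv_mul_cancel_right₀ hs0, sub_self]
  obtain ⟨c, hc, hcoer⟩ := exists_coercive (norm_ne_zero_iff.1 (hu₂n ▸ one_ne_zero)) hHpos hHker
  obtain ⟨p, s, hpm, hp0, hs1, hps, hrate⟩ := exists_chebyshev hγ.1.1 (hγ.2 hΓ.1) hm
  -- The spectrum of `H` is contained in `{0} ∪ [γ, Γ]`.
  have hspec : ∀ (z : ℝ) (e : EuclideanSpace ℂ (Fin n)), e ≠ 0 → H e = (z : ℂ) • e →
      0 ≤ z * (s - p.eval z ^ 2) := by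
    intro z e he hz
    have hz0 : 0 ≤ z := by
      have h1 := hHpos e
      rw [hz, inner_smul_right, inner_self_eq_norm_sq_to_K, Complex.re_ofReal_mul] at h1
      have h2 : 0 < ‖e‖ ^ 2 := by have := norm_pos_iff.2 he; positivity
      have h3 : (((‖e‖ : ℝ) : ℂ) ^ 2).re = ‖e‖ ^ 2 := by
        rw [← Complex.ofReal_pow, Complex.ofReal_re]
      have h4 : 0 ≤ z * ‖e‖ ^ 2 := by rw [← h3]; exact h1
      exact nonneg_of_mul_nonneg_left h4 h2
    rcases hz0.eq_or_lt with rfl | hzpos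
    · simp
    have hmem : z ∈ positiveEigenvalues (-(K * quadF A B C t)) := by
      refine ⟨hzpos, Module.End.hasEigenvalue_of_hasEigenvector (x := congrVec T e)
        ⟨Module.End.mem_eigenspace_iff.2 ?_, fun h => he (hinj e h)⟩⟩
      rw [Matrix.toLin'_apply, ← Matrix.mul_neg, ← congrVec_congrOp hTK, ← hH, hz, map_smul]
    exact mul_nonneg hz0 (sub_nonneg.2 (hps z ⟨hγ.2 hmem, hΓ.2 hmem⟩))
  have hν : 0 < (inner ℂ u₂ (congrOp T (quadF' A B t) u₂)).re := by
    rw [inner_congrOp hT]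
    exact re_quadF'_pos hA hF hlt hu₂0 hFu₂
  obtain ⟨ε, hε, M, hM⟩ := exists_uniform_two_step (A := congrOp T A) hu₂n hHsymm hHu hc hcoer hν
    hp0 hs1 (re_inner_aeval_le hHsymm hspec)
  refine ⟨ε, hε, M, fun ρ x d Z y h hle i hi => ?_⟩
  rw [← hrate]
  have hanti := h.antitone hA hB hC hF
  obtain ⟨x₀, hx₀⟩ := hlift (x i)
  obtain ⟨x₁, hx₁⟩ := hlift (x (i + 1))
  have hpen : ∀ j, opPencil H (congrOp T (quadF' A B t)) (congrOp T A) (ρ j - t) =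
      congrOp T (quadF A B C (ρ j)) := by
    intro j
    rw [hH, opPencil_congrOp, add_sub_cancel]
  have hmem : ∀ j e, congrVec T e = x j →
      congrVec T (Polynomial.aeval (-(congrOp T (quadF A B C (ρ j)))) p e) ∈
        searchSpace A B C K m ρ x j := by
    intro j e he
    refine congrVec_aeval_mem hTK hpm fun k hk => ?_
    rw [he]
    exact pow_mulVec_mem_searchSpace j hk
  refine hM (ρ i - t) (ρ (i + 1) - t) (ρ (i + 2) - t) x₀ x₁ ?_ hi
  refine ⟨?_, ?_, sub_nonneg.2 (hle _), sub_nonneg.2 (hle _),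
    sub_le_sub_right (hanti (Nat.le_succ _)) _, sub_le_sub_right (hanti (Nat.le_succ _)) _,
    ?_, ?_, ?_, ?_⟩
  · rintro rfl
    exact h.iterate_ne i (by rw [← hx₀, map_zero])
  · rintro rfl
    exact h.iterate_ne (i + 1) (by rw [← hx₁, map_zero])
  · rw [hpen, inner_congrOp hT, hx₀, h.rayleigh_root]
  · rw [hpen, inner_congrOp hT, hx₁, h.rayleigh_root]
  · rw [hpen, hpen, inner_congrOp hT, hx₁]
    exact h.galerkin (hmem i x₀ hx₀)
  · intro a b
    rw [hpen, hpen, inner_congrOp hT]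
    refine h.re_dotProduct_nonpos hA.isHermitian hB hC hF (i := i + 1) ?_
    rw [map_add, map_smul, map_smul, hx₀]
    exact Submodule.add_mem _ (Submodule.smul_mem _ _ (hmem (i + 1) x₁ hx₁))
      (Submodule.smul_mem _ _ (prev_mem_searchSpace i))

theorem theorem3p2 {n : ℕ} (hn : 2 ≤ n) (A B C K : Matrix (Fin n) (Fin n) ℂ) (lam0 : ℝ)
    (hA : A.PosDef) (hB : B.IsHermitian) (hC : C.IsHermitian)
    (hF : (-(quadF A B C lam0)).PosDef) (hK : K.PosDef) (m : ℕ) (hm : 1 ≤ m) :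
    (∀ (ρ : ℕ → ℝ) (x : ℕ → Fin n → ℂ) (d : ℕ → ℕ)
        (Z : (i : ℕ) → Matrix (Fin n) (Fin (d i)) ℂ) (y : (i : ℕ) → Fin (d i) → ℂ),
      IsLOCG A B C lam0 m (fun _ => K) ρ x d Z y →
      posEig A B C lam0 1 ≤ ρ 0 → ρ 0 < posEig A B C lam0 2 →
      (∀ i, ((Z i).conjTranspose * (CFC.sqrt K * quadF' A B (posEig A B C lam0 1) * CFC.sqrt K)
        * Z i).PosDef) →
      Antitone ρ ∧ Tendsto ρ atTop (𝓝 (posEig A B C lam0 1)) ∧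
      (∃ u : Fin n → ℂ, u ≠ 0 ∧ (quadF A B C (posEig A B C lam0 1)).mulVec u = 0 ∧
        ∃ c : ℕ → ℂ, (∀ i, c i ≠ 0) ∧ Tendsto (fun i => c i • x i) atTop (𝓝 u)) ∧
      ((∀ i, dotProduct (star (x i)) (A.mulVec (x i)) = 1) →
        Tendsto (fun i => (quadF A B C (ρ i)).mulVec (x i)) atTop (𝓝 0))) ∧
    (∀ γ Γ : ℝ,
      IsLeast (positiveEigenvalues (-(K * quadF A B C (posEig A B C lam0 1)))) γ →
      IsGreatest (positiveEigenvalues (-(K * quadF A B C (posEig A B C lam0 1)))) Γ →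
      ∃ ε > (0 : ℝ), ∃ M : ℝ,
        ∀ (ρ : ℕ → ℝ) (x : ℕ → Fin n → ℂ) (d : ℕ → ℕ)
          (Z : (i : ℕ) → Matrix (Fin n) (Fin (d i)) ℂ) (y : (i : ℕ) → Fin (d i) → ℂ),
        IsLOCG A B C lam0 m (fun _ => K) ρ x d Z y →
        posEig A B C lam0 1 ≤ ρ 0 → ρ 0 < posEig A B C lam0 2 →
        (∀ i, ((Z i).conjTranspose *
          (CFC.sqrt K * quadF' A B (posEig A B C lam0 1) * CFC.sqrt K) * Z i).PosDef) →
        ∀ i, 1 ≤ i → ρ i - posEig A B C lam0 1 < ε →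
          ρ (i + 1) - posEig A B C lam0 1 ≤
            chebRate (Γ / γ) m ^ 2 * (ρ (i - 1) - posEig A B C lam0 1)
              + M * (ρ (i - 1) - posEig A B C lam0 1) ^ (3 / 2 : ℝ)) := by
  refine ⟨?_, ?_⟩
  · intro ρ x d Z y h _ hlt _
    obtain ⟨hρ, u, ⟨-, hu, hFu, -⟩, hker⟩ := h.exists_simple_limit hA hB hC hF hK hm hlt
    obtain ⟨c, hc, hlim⟩ :=
      h.exists_scaling_tendsto hA.isHermitian hB hC hF hK hm hρ hu hker
    exact ⟨h.antitone hA hB hC hF, hρ, ⟨u, hu, hFu, c, hc, hlim⟩,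
      IsLOCG.residual_tendsto_zero hA hρ hu hFu hc hlim⟩
  · intro γ Γ hγ hΓ
    set t := posEig A B C lam0 1 with ht
    -- The existence of one run of the method shows that `t` is a simple eigenvalue.
    by_cases hex : ∃ u : Fin n → ℂ, IsMinEigenpair (quadF A B C) lam0 t u ∧
        ∀ v, (quadF A B C t).mulVec v = 0 → ∃ c : ℂ, v = c • u
    swap
    · refine ⟨1, one_pos, 0, fun ρ x d Z y h _ hlt _ => ?_⟩
      exact absurd (h.exists_simple_limit hA hB hC hF hK hm hlt).2 hex
    obtain ⟨u, hmin, hker⟩ := hex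
    obtain ⟨ε, hε, M, hM⟩ := exists_rate_constants hA hB hC hF hK hm hmin hker hγ hΓ
    have hε' : 0 < √ε := Real.sqrt_pos.2 hε
    -- The second constant makes the bound trivial when `ρ (i - 1) - t ≥ ε`.
    refine ⟨1, one_pos, max M (√ε)⁻¹, fun ρ x d Z y h _ hlt _ i hi _ => ?_⟩
    obtain ⟨k, rfl⟩ := Nat.exists_eq_add_of_le' hi
    have hanti := h.antitone hA hB hC hF
    have hle : ∀ j, t ≤ ρ j :=
      hanti.le_of_tendsto (h.exists_simple_limit hA hB hC hF hK hm hlt).1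
    rw [Nat.add_sub_cancel, add_assoc, one_add_one_eq_two]
    have hδ : 0 ≤ ρ k - t := sub_nonneg.2 (hle k)
    have hpow : (ρ k - t) ^ (3 / 2 : ℝ) = √(ρ k - t) ^ 3 := by
      rw [Real.rpow_div_two_eq_sqrt _ hδ]
      exact_mod_cast Real.rpow_natCast (√(ρ k - t)) 3
    rw [hpow]
    have h3 : 0 ≤ √(ρ k - t) ^ 3 := by positivity
    rcases lt_or_ge (ρ k - t) ε with hlt' | hge
    · refine (hM ρ x d Z y h hle k hlt').trans ?_
      gcongr
      exact le_max_left _ _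
    · have h1 : ρ (k + 2) - t ≤ ρ k - t := sub_le_sub_right (hanti (by omega)) _
      have h2 : ρ k - t ≤ (√ε)⁻¹ * √(ρ k - t) ^ 3 := by
        rw [pow_succ', Real.sq_sqrt hδ, ← mul_assoc]
        refine le_mul_of_one_le_left hδ ?_
        rw [← div_eq_inv_mul, one_le_div hε']
        exact Real.sqrt_le_sqrt hge
      have h4 := mul_le_mul_of_nonneg_right (le_max_right M (√ε)⁻¹) h3
      have h5 : 0 ≤ chebRate (Γ / γ) m ^ 2 * (ρ k - t) := by positivity
      linarith
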